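/- Let $d\ge 1$, let $(\Omega,\mathcal A,\mu)$ be a probability space and let $(T_{\underline i})_{\underline i\in\mathbb Z^d}$ be a $\mathbb Z^d$ action on $\Omega$ by measurable, $\mu$-preserving transformations (so $T_{\underline 0}=\mathrm{id}$ and $T_{\underline i+\underline j}=T_{\underline i}\circ T_{\underline j}$). Write $\underline i\le\underline j$ for the coordinatewise order of $\mathbb Z^d$, $\underline i\wedge\underline j$ for the coordinatewise minimum, and $e_q$ for the $q$-th standard unit vector. Let $(\mathcal F_{\underline i})_{\underline i\in\mathbb Z^d}$ be a completely commuting filtration, that is, a family of sub-$\sigma$-algebras of $\mathcal A$ such that (i) $\mathcal F_{\underline i}=T_{\underline i}^{-1}\mathcal F_{\underline 0}$ for all $\underline i\in\mathbb Z^d$; (ii) $\mathcal F_{\underline i}\subset\mathcal F_{\underline j}$ whenever $\underline i\le\underline j$; (iii) $\mathcal F_{\underline i}\cap\mathcal F_{\underline j}=\mathcal F_{\underline i\wedge\underline j}$ up to $\mu$-null sets, for all $\underline i,\underline j\in\mathbb Z^d$; (iv) $E\big(E(g\mid\mathcal F_{\underline i})\,\big|\,\mathcal F_{\underline j}\big)=E(g\mid\mathcal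 F_{\underline i\wedge\underline j})$ almost surely, for every integrable $g:\Omega\to\mathbb R$ and all $\underline i,\underline j\in\mathbb Z^d$. Let $f\in L^2(\mu)$ be real-valued and such that $(f\circ T_{\underline i})_{\underline i\in\mathbb Z^d}$ is a field of martingale differences for this filtration, that is, $f$ is $\mathcal F_{\underline 0}$-measurable (up to a $\mu$-null set) and $E(f\mid\mathcal F_{\underline i})=0$ almost surely for every $\underline i=(i_1,\dots,i_d)$ with $i_q\le 0$ for all $q$ and $i_q<0$ for at least one $q$. Suppose that at least one of the transformations $T_{e_1},\dots,T_{e_d}$ is ergodic with respect to $\mu$. Then, as $n_1,\dots,n_d\to\infty$ (all of them tending to infinity, with no condition on their relative rates), the distributions of $$\frac1{\sqrt{n_1\cdots n_d}}\sum_{i_1=1}^{n_1}\cdots\sum_{i_d=1}^{n_d} f\circ T_{(i_1,\dots,i_d)}$$ converge weakly to $\mathcal N(0,\sigma^2)$ with $\sigma^2=\|f\|_2^2=\int f^2\,d\mu$ (the point mass at $0$ if $\sigma^2=0$). -/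

import Mathlib

open MeasureTheory ProbabilityTheory Filter
open scoped MeasureTheory Topology

/-- Invariant commuting filtrations indexed by `ℤ^d`. The transformation `T_i` is `ω ↦ i +ᵥ ω`.
`Filtration (Fin d → ℤ) mΩ` says that the `ℱ i` are sub-σ-algebras of `mΩ`, increasing for the
coordinatewise order of `ℤ^d`. -/
structure IsInvariantCommutingFiltration {Ω : Type*} {mΩ : MeasurableSpace Ω} {d : ℕ}
    [AddAction (Fin d → ℤ) Ω] (μ : Measure Ω) (ℱ : Filtration (Fin d → ℤ) mΩ) : Prop where
  /-- `ℱ_i = T_i⁻¹ ℱ_0`. -/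
  invariant : ∀ i : Fin d → ℤ, ℱ i = MeasurableSpace.comap (fun ω : Ω => i +ᵥ ω) (ℱ 0)
  /-- `ℱ_i ∩ ℱ_j = ℱ_{i ∧ j}` up to `μ`-null sets (the inclusion `⊇` is monotonicity). For
  completely commuting filtrations this is implied by the exact equality of σ-algebras. -/
  inter : ∀ (i j : Fin d → ℤ) (A B : Set Ω), MeasurableSet[ℱ i] A → MeasurableSet[ℱ j] B →
    A =ᵐ[μ] B → ∃ C : Set Ω, MeasurableSet[ℱ (i ⊓ j)] C ∧ C =ᵐ[μ] A

/-- Completely commuting filtrations: invariant commuting filtrations such that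
`E(E(g | ℱ_i) | ℱ_j) = E(g | ℱ_{i ∧ j})` for every integrable `g`. -/
structure IsCompletelyCommutingFiltration {Ω : Type*} {mΩ : MeasurableSpace Ω} {d : ℕ}
    [AddAction (Fin d → ℤ) Ω] (μ : Measure Ω) (ℱ : Filtration (Fin d → ℤ) mΩ) : Prop
    extends IsInvariantCommutingFiltration μ ℱ where
  condExp_condExp : ∀ (g : Ω → ℝ), Integrable g μ → ∀ i j : Fin d → ℤ,
    μ[μ[g | ℱ i] | ℱ j] =ᵐ[μ] μ[g | ℱ (i ⊓ j)]

/-- `(f ∘ T_i)_{i ∈ ℤ^d}` is a field of martingale differences: `f` is `ℱ_0`-measurable (as an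
element of `L²`, that is, up to a null set) and `E(f | ℱ_i) = 0` whenever all coordinates of `i`
are `≤ 0` and at least one is `< 0`. -/
structure IsMartingaleDifferenceField {Ω : Type*} {mΩ : MeasurableSpace Ω} {d : ℕ}
    (μ : Measure Ω) (ℱ : Filtration (Fin d → ℤ) mΩ) (f : Ω → ℝ) : Prop where
  measurable : AEStronglyMeasurable[ℱ 0] f μ
  condExp_eq_zero : ∀ i : Fin d → ℤ, (∀ q, i q ≤ 0) → (∃ q, i q < 0) → μ[f | ℱ i] =ᵐ[μ] 0

/-- The normalized rectangular sum
`(n_1 ⋯ n_d)^{-1/2} ∑_{i_1 = 1}^{n_1} ⋯ ∑_{i_d = 1}^{n_d} f ∘ T_{(i_1, …, i_d)}`. -/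
noncomputable def normalizedSum {Ω : Type*} {d : ℕ} [AddAction (Fin d → ℤ) Ω] (f : Ω → ℝ)
    (n : Fin d → ℕ) (ω : Ω) : ℝ :=
  (√(∏ q, (n q : ℝ)))⁻¹ *
    ∑ i ∈ Fintype.piFinset (fun q => Finset.Icc (1 : ℤ) (n q)), f (i +ᵥ ω)

/-! The rectangle is built up one direction at a time, starting from an ergodic direction `q₀`.
Suppose the limit law is known for rectangles in the directions of a set `s` containing `q₀`, for
every function that is a martingale difference in those directions, and let `p ∉ s`. The normalized
sums `F_n` over the `s`-rectangle are stationary martingale differences along `T = T_{e_p}`, and the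
sum over the enlarged rectangle is `(n_p)^{-1/2} ∑_j F_n ∘ T^j`. This is a one-dimensional problem,
but for an array whose rows change with `n`.

The array theorem `tendsto_integral_cexp_of_blocks` cuts the row into blocks of a fixed length `m`.
Adding a block multiplies the characteristic function at `t` by about `exp (-t² m σ² / (2 n_p))`. Up
to terms vanishing as `n_p → ∞`, the error is governed by the `L¹` distance from the sum of the `m`
squares to `m σ²` and by the truncated tail of the squared block sum. So a law of large numbers for
the squares, in long blocks of fixed length, is all that is needed.

In the ergodic direction it is the mean ergodic theorem (`Ergodic.exists_block`). In a further
direction `T_{e_p}` need not be ergodic. Instead, the induction hypothesis applied to `∑ a_u g ∘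
T^u` shows, by the Cramér–Wold device, that `(F_n ∘ T^u)_{u < m}` is asymptotically a vector of
independent `N(0, σ²)` variables, whose squares do obey that law (`exists_block_of_tendsto_joint`).
Since `m` is fixed before `n` goes to infinity along the product filter, no relation between the
rates of the `n_q` enters.

Complete commutation makes `E(f | ℱ_i)` vanish as soon as a single coordinate of `i` is negative, so
that `f` is a martingale difference in each direction separately. -/

/-! ### Integrals against functions with vanishing conditional expectation -/

section Orthogonality

variable {Ω : Type*} {m mΩ : MeasurableSpace Ω} {μ : Measure Ω} [IsFiniteMeasure μ]

/-- If `X` has integral zero over all sets of `m`, then it is orthogonal to `m`-measurable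
functions. -/
theorem integral_mul_eq_zero_of_forall_setIntegral_eq_zero (hm : m ≤ mΩ) {Z X : Ω → ℝ}
    (hZ : AEStronglyMeasurable[m] Z μ) (hX : Integrable X μ) (hZX : Integrable (Z * X) μ)
    (h : ∀ A, MeasurableSet[m] A → ∫ ω in A, X ω ∂μ = 0) : ∫ ω, Z ω * X ω ∂μ = 0 := by
  have h0 : (0 : Ω → ℝ) =ᵐ[μ] μ[X | m] := by
    refine ae_eq_condExp_of_forall_setIntegral_eq hm hX (fun s _ _ => integrableOn_zero)
      (fun s hs _ => ?_) aestronglyMeasurable_const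
    simp [h s hs]
  have h1 := condExp_mul_of_aestronglyMeasurable_left hZ hZX hX
  calc ∫ ω, Z ω * X ω ∂μ = ∫ ω, (μ[Z * X | m]) ω ∂μ := (integral_condExp hm).symm
    _ = ∫ _, (0 : ℝ) ∂μ := by
        refine integral_congr_ae ?_
        filter_upwards [h0, h1] with ω h0 h1
        rw [h1, Pi.mul_apply, ← h0]; simp
    _ = 0 := by simp

theorem integral_mul_ofReal_eq_zero_of_forall_setIntegral_eq_zero (hm : m ≤ mΩ) {Z : Ω → ℂ}
    {X : Ω → ℝ} (hZ : AEStronglyMeasurable[m] Z μ) (hX : Integrable X μ)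
    (hZX : Integrable (fun ω => Z ω * (X ω : ℂ)) μ)
    (h : ∀ A, MeasurableSet[m] A → ∫ ω in A, X ω ∂μ = 0) : ∫ ω, Z ω * (X ω : ℂ) ∂μ = 0 := by
  have hre : ∫ ω, (Z ω).re * X ω ∂μ = 0 := by
    refine integral_mul_eq_zero_of_forall_setIntegral_eq_zero hm
      (Complex.continuous_re.comp_aestronglyMeasurable hZ) hX ?_ h
    simpa [Pi.mul_def] using hZX.re
  have him : ∫ ω, (Z ω).im * X ω ∂μ = 0 := by
    refine integral_mul_eq_zero_of_forall_setIntegral_eq_zero hm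
      (Complex.continuous_im.comp_aestronglyMeasurable hZ) hX ?_ h
    simpa [Pi.mul_def] using hZX.im
  have h1 := integral_re_add_im (𝕜 := ℂ) hZX
  rw [← h1]
  simp [hre, him]

end Orthogonality

theorem sq_integral_abs_le {Ω : Type*} {mΩ : MeasurableSpace Ω} {μ : Measure Ω}
    [IsProbabilityMeasure μ] {X : Ω → ℝ} (hX : MemLp X 2 μ) :
    (∫ ω, |X ω| ∂μ) ^ 2 ≤ ∫ ω, X ω ^ 2 ∂μ := by
  have hv := variance_nonneg |X| μ
  rw [variance_eq_sub hX.abs] at hv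
  simpa using hv

/-! ### Taylor estimates -/

/-- Only second moments are available, so the cubic bound, used for `|y| ≤ 1`, is paired with a
quadratic one for large `y`, where each term is bounded separately. -/
theorem norm_exp_mul_I_sub_taylor_le (y : ℝ) :
    ‖Complex.exp (y * Complex.I) - (1 + y * Complex.I - (y : ℂ) ^ 2 / 2)‖
      ≤ 4 * min (y ^ 2) (|y| ^ 3) := by
  have hn : ‖(y : ℂ) * Complex.I‖ = |y| := by simp
  rcases le_or_gt |y| 1 with h | h
  · have h1 := Complex.exp_bound (x := y * Complex.I) (by rw [hn]; exact h) (n := 3) (by norm_num)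
    have h2 : ∑ m ∈ Finset.range 3, ((y : ℂ) * Complex.I) ^ m / (m.factorial : ℂ)
        = 1 + y * Complex.I - (y : ℂ) ^ 2 / 2 := by
      simp [Finset.sum_range_succ, mul_pow, Complex.I_sq, Nat.factorial]; ring
    rw [h2, hn] at h1
    refine h1.trans ?_
    have h3 : |y| ^ 3 ≤ y ^ 2 := by
      rw [← sq_abs]; exact pow_le_pow_of_le_one (abs_nonneg y) h (by norm_num)
    rw [min_eq_right h3]
    have : (0 : ℝ) ≤ |y| ^ 3 := by positivity
    norm_num [Nat.factorial]
    linarith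
  · have h3 : y ^ 2 ≤ |y| ^ 3 := by
      rw [← sq_abs]; exact pow_le_pow_right₀ h.le (by norm_num)
    rw [min_eq_left h3]
    have h4 : ‖Complex.exp (y * Complex.I)‖ = 1 := Complex.norm_exp_ofReal_mul_I y
    have h5 : ‖(1 + y * Complex.I - (y : ℂ) ^ 2 / 2)‖ ≤ 1 + |y| + y ^ 2 / 2 := by
      refine (norm_sub_le _ _).trans (add_le_add ((norm_add_le _ _).trans ?_) ?_)
      · simp
      · simp
    have h6 := norm_sub_le (Complex.exp (y * Complex.I)) (1 + y * Complex.I - (y : ℂ) ^ 2 / 2)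
    have h7 : 1 ≤ y ^ 2 := by rw [← sq_abs]; nlinarith
    have h8 : |y| ≤ y ^ 2 := by rw [← sq_abs]; nlinarith
    linarith

theorem abs_exp_neg_sub_one_sub_le {x : ℝ} (hx : 0 ≤ x) : |Real.exp (-x) - (1 - x)| ≤ x ^ 2 := by
  rcases le_or_gt x 1 with h | h
  · have := Real.abs_exp_sub_one_sub_id_le (x := -x) (by rwa [abs_neg, abs_of_nonneg hx])
    rwa [neg_sq, show Real.exp (-x) - 1 - -x = Real.exp (-x) - (1 - x) by ring] at this
  · have h1 : Real.exp (-x) ≤ 1 := Real.exp_le_one_iff.2 (by linarith)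
    have h2 := Real.add_one_le_exp (-x)
    rw [abs_of_nonneg (by linarith)]
    nlinarith

theorem abs_exp_neg_sub_exp_neg_le {x y : ℝ} (hx : 0 ≤ x) (hxy : x ≤ y) :
    |Real.exp (-x) - Real.exp (-y)| ≤ y - x := by
  have h1 : Real.exp (-y) ≤ Real.exp (-x) := Real.exp_le_exp.2 (by linarith)
  rw [abs_of_nonneg (by linarith)]
  have h2 := Real.add_one_le_exp (-(y - x))
  have h3 : Real.exp (-y) = Real.exp (-x) * Real.exp (-(y - x)) := by
    rw [← Real.exp_add]; congr 1; ring
  have h4 : Real.exp (-x) ≤ 1 := Real.exp_le_one_iff.2 (by linarith)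
  rw [h3]
  nlinarith [Real.exp_pos (-x)]

/-- Split at `g² = 2L`. Below, the cube gains the factor `|a| √(2L)`, small when `a` is; above, `g²
≤ 2 (g² - L)`, so the tail of `g²` beyond `L` dominates. Uniform integrability thus replaces a third
moment. -/
theorem min_sq_cube_le {a g L : ℝ} (hL : 0 ≤ L) :
    min ((a * g) ^ 2) (|a * g| ^ 3)
      ≤ a ^ 2 * (2 * (g ^ 2 - min (g ^ 2) L)) + a ^ 2 * (|a| * √(2 * L) * g ^ 2) := by
  have ha : 0 ≤ a ^ 2 := sq_nonneg a
  have h0 : 0 ≤ g ^ 2 - min (g ^ 2) L := sub_nonneg.2 (min_le_left _ _)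
  rcases le_or_gt (g ^ 2) (2 * L) with h | h
  · have hg : |g| ≤ √(2 * L) := Real.abs_le_sqrt h
    calc min ((a * g) ^ 2) (|a * g| ^ 3) ≤ |a * g| ^ 3 := min_le_right _ _
      _ = a ^ 2 * (|a| * |g| * g ^ 2) := by
          rw [pow_succ, sq_abs, abs_mul]; ring
      _ ≤ a ^ 2 * (|a| * √(2 * L) * g ^ 2) := by gcongr
      _ ≤ _ := le_add_of_nonneg_left (by positivity)
  · have : min (g ^ 2) L = L := min_eq_right (by linarith)
    rw [this]
    calc min ((a * g) ^ 2) (|a * g| ^ 3) ≤ (a * g) ^ 2 := min_le_left _ _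
      _ = a ^ 2 * g ^ 2 := by ring
      _ ≤ a ^ 2 * (2 * (g ^ 2 - L)) := by gcongr; linarith
      _ ≤ _ := le_add_of_nonneg_right (by positivity)

/-! ### One step of the characteristic function estimate -/

section Step

variable {Ω : Type*} {mΩ : MeasurableSpace Ω} {μ : Measure Ω}

theorem aestronglyMeasurable_cexp_mul_I {m : MeasurableSpace Ω} {W : Ω → ℝ}
    (hW : AEStronglyMeasurable[m] W μ) :
    AEStronglyMeasurable[m] (fun ω => Complex.exp ((W ω : ℂ) * Complex.I)) μ := by
  have : Continuous (fun x : ℝ => Complex.exp ((x : ℂ) * Complex.I)) := by fun_prop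
  exact this.comp_aestronglyMeasurable hW

theorem integrable_cexp_mul_I [IsFiniteMeasure μ] {W : Ω → ℝ} (hW : AEStronglyMeasurable W μ) :
    Integrable (fun ω => Complex.exp ((W ω : ℂ) * Complex.I)) μ :=
  Integrable.of_bound (aestronglyMeasurable_cexp_mul_I hW) 1
    (Eventually.of_forall fun _ => (Complex.norm_exp_ofReal_mul_I _).le)

theorem integrable_cexp_mul_I_mul {W X : Ω → ℝ} (hW : AEStronglyMeasurable W μ)
    (hX : Integrable X μ) :
    Integrable (fun ω => Complex.exp ((W ω : ℂ) * Complex.I) * (X ω : ℂ)) μ :=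
  hX.ofReal.bdd_mul (aestronglyMeasurable_cexp_mul_I hW)
    (Eventually.of_forall fun _ => (Complex.norm_exp_ofReal_mul_I _).le)

theorem norm_integral_cexp_mul_I_mul_le {W X : Ω → ℝ} :
    ‖∫ ω, Complex.exp ((W ω : ℂ) * Complex.I) * (X ω : ℂ) ∂μ‖ ≤ ∫ ω, |X ω| ∂μ := by
  refine (norm_integral_le_integral_norm _).trans (le_of_eq ?_)
  congr 1; ext ω
  rw [norm_mul, Complex.norm_exp_ofReal_mul_I, one_mul, Complex.norm_real, Real.norm_eq_abs]

/-- If `Y` is centered and has conditional variance close to `c` given the past of `W`, then adding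
`Y` to `W` multiplies the characteristic function by about `exp (-c / 2)`. -/
theorem norm_integral_cexp_add_sub_le [IsProbabilityMeasure μ] {W Y : Ω → ℝ} {c η : ℝ} (hc : 0 ≤ c)
    (hW : AEStronglyMeasurable W μ) (hY : MemLp Y 2 μ)
    (h1 : ∫ ω, Complex.exp ((W ω : ℂ) * Complex.I) * (Y ω : ℂ) ∂μ = 0)
    (h2 : ‖∫ ω, Complex.exp ((W ω : ℂ) * Complex.I) * ((Y ω ^ 2 - c : ℝ) : ℂ) ∂μ‖ ≤ η) :
    ‖(∫ ω, Complex.exp (((W ω + Y ω : ℝ) : ℂ) * Complex.I) ∂μ)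
        - (Real.exp (-(c / 2)) : ℂ) * ∫ ω, Complex.exp ((W ω : ℂ) * Complex.I) ∂μ‖
      ≤ η / 2 + 4 * (∫ ω, min (Y ω ^ 2) (|Y ω| ^ 3) ∂μ) + c ^ 2 / 4 := by
  have hYi : Integrable Y μ := hY.integrable (by norm_num)
  have hY2 : Integrable (fun ω => Y ω ^ 2) μ := hY.integrable_sq
  have hmin : Integrable (fun ω => min (Y ω ^ 2) (|Y ω| ^ 3)) μ := by
    refine hY2.mono' ?_ (Eventually.of_forall fun ω => ?_)
    · have : Continuous (fun x : ℝ => min (x ^ 2) (|x| ^ 3)) := by fun_prop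
      exact this.comp_aestronglyMeasurable hY.1
    · rw [Real.norm_of_nonneg (by positivity)]; exact min_le_left _ _
  have iW := integrable_cexp_mul_I (μ := μ) hW
  have iWY := integrable_cexp_mul_I (μ := μ) (hW.add hY.1)
  have iY := integrable_cexp_mul_I_mul hW hYi
  have iY2 := integrable_cexp_mul_I_mul (X := fun ω => Y ω ^ 2 - c) hW (hY2.sub (integrable_const c))
  set R : Ω → ℂ := fun ω => Complex.exp ((W ω : ℂ) * Complex.I) *
    (Complex.exp (Y ω * Complex.I) - (1 + Y ω * Complex.I - (Y ω : ℂ) ^ 2 / 2)) with hR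
  -- Second-order expansion of `exp (iY)` with `Y² = (Y² - c) + c`: the linear term integrates to
  -- zero by `h1`, the `Y² - c` term is small by `h2`, and the factor `1 - c/2` becomes `exp (-c/2)`
  -- at cost `c²/4`.
  have hdec : ∀ ω, Complex.exp (((W ω + Y ω : ℝ) : ℂ) * Complex.I)
      = R ω + Complex.I * (Complex.exp ((W ω : ℂ) * Complex.I) * (Y ω : ℂ))
        - (1 / 2 : ℂ) * (Complex.exp ((W ω : ℂ) * Complex.I) * ((Y ω ^ 2 - c : ℝ) : ℂ))
        + (1 - c / 2 : ℂ) * Complex.exp ((W ω : ℂ) * Complex.I) := by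
    intro ω
    simp only [hR]
    push_cast
    rw [add_mul, Complex.exp_add]
    ring
  have iR : Integrable R μ := by
    have : R = fun ω => Complex.exp (((W ω + Y ω : ℝ) : ℂ) * Complex.I)
        - Complex.I * (Complex.exp ((W ω : ℂ) * Complex.I) * (Y ω : ℂ))
        + (1 / 2 : ℂ) * (Complex.exp ((W ω : ℂ) * Complex.I) * ((Y ω ^ 2 - c : ℝ) : ℂ))
        - (1 - c / 2 : ℂ) * Complex.exp ((W ω : ℂ) * Complex.I) := by
      ext ω; rw [hdec ω]; ring
    rw [this]
    exact ((iWY.sub (iY.const_mul _)).add (iY2.const_mul _)).sub (iW.const_mul _)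
  have hRle : ‖∫ ω, R ω ∂μ‖ ≤ 4 * (∫ ω, min (Y ω ^ 2) (|Y ω| ^ 3) ∂μ) := by
    rw [← integral_const_mul]
    refine norm_integral_le_of_norm_le (hmin.const_mul 4) (Eventually.of_forall fun ω => ?_)
    simp only [hR, norm_mul, Complex.norm_exp_ofReal_mul_I, one_mul]
    exact norm_exp_mul_I_sub_taylor_le (Y ω)
  have hint : ∫ ω, Complex.exp (((W ω + Y ω : ℝ) : ℂ) * Complex.I) ∂μ
      = ∫ ω, R ω ∂μ
        - (1 / 2 : ℂ) * ∫ ω, Complex.exp ((W ω : ℂ) * Complex.I) * ((Y ω ^ 2 - c : ℝ) : ℂ) ∂μ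
        + (1 - c / 2 : ℂ) * ∫ ω, Complex.exp ((W ω : ℂ) * Complex.I) ∂μ := by
    simp_rw [hdec]
    rw [integral_add ((iR.fun_add (iY.const_mul _)).sub' (iY2.const_mul _)) (iW.const_mul _),
      integral_sub (iR.fun_add (iY.const_mul _)) (iY2.const_mul _),
      integral_add iR (iY.const_mul _), integral_const_mul, integral_const_mul,
      integral_const_mul, h1]
    simp
  have hle1 : ‖∫ ω, Complex.exp ((W ω : ℂ) * Complex.I) ∂μ‖ ≤ 1 := by
    refine (norm_integral_le_integral_norm _).trans (le_of_eq ?_)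
    simp [Complex.norm_exp_ofReal_mul_I]
  have hexp : ‖((1 - c / 2 : ℂ) - (Real.exp (-(c / 2)) : ℂ))‖ ≤ c ^ 2 / 4 := by
    have h := abs_exp_neg_sub_one_sub_le (x := c / 2) (by positivity)
    have : ((1 - c / 2 : ℂ) - (Real.exp (-(c / 2)) : ℂ))
        = ((-(Real.exp (-(c / 2)) - (1 - c / 2)) : ℝ) : ℂ) := by push_cast; ring
    rw [this, Complex.norm_real, Real.norm_eq_abs, abs_neg]
    linarith
  rw [hint]
  have : ∀ A B C x y : ℂ, A - (1 / 2) * B + x * C - y * C = A - (1 / 2) * B + (x - y) * C := by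
    intros; ring
  rw [this]
  have hlast := mul_le_mul hexp hle1 (norm_nonneg _) (by positivity)
  rw [← norm_mul, mul_one] at hlast
  refine (norm_add_le _ _).trans (add_le_add ((norm_sub_le _ _).trans ?_) hlast)
  rw [add_comm]
  refine add_le_add ?_ hRle
  rw [norm_mul, show ‖(1 / 2 : ℂ)‖ = 1 / 2 by norm_num]
  linarith

end Step

/-! ### Stationary martingale differences -/

theorem aestronglyMeasurable_sum_of_sub_measurableSpace {Ω ι : Type*} {m mΩ : MeasurableSpace Ω}
    {μ : Measure Ω} (s : Finset ι) {f : ι → Ω → ℝ}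
    (hf : ∀ i ∈ s, AEStronglyMeasurable[m] (f i) μ) :
    AEStronglyMeasurable[m] (fun ω => ∑ i ∈ s, f i ω) μ := by
  classical
  induction s using Finset.induction_on with
  | empty => simpa using (aestronglyMeasurable_const : AEStronglyMeasurable[m] (fun _ => (0 : ℝ)) μ)
  | insert i s hi ih =>
    simp_rw [Finset.sum_insert hi]
    exact (hf i (Finset.mem_insert_self i s)).add
      (ih fun j hj => hf j (Finset.mem_insert_of_mem hj))

/-- The functions `F ∘ T^k` are martingale differences with respect to the increasing family `𝒢`. -/
structure IsStationaryMartingaleDifference {Ω : Type*} {mΩ : MeasurableSpace Ω} (μ : Measure Ω)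
    (T : Ω → Ω) (𝒢 : ℕ → MeasurableSpace Ω) (F : Ω → ℝ) : Prop where
  measurePreserving : MeasurePreserving T μ μ
  le : ∀ k, 𝒢 k ≤ mΩ
  mono : Monotone 𝒢
  memLp : MemLp F 2 μ
  aestronglyMeasurable : ∀ k, AEStronglyMeasurable[𝒢 k] (fun ω => F (T^[k] ω)) μ
  setIntegral_eq_zero : ∀ k j, k < j → ∀ A, MeasurableSet[𝒢 k] A →
    ∫ ω in A, F (T^[j] ω) ∂μ = 0

theorem MeasureTheory.MeasurePreserving.integral_comp_aestronglyMeasurable {Ω : Type*}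
    {mΩ : MeasurableSpace Ω} {μ : Measure Ω} {T : Ω → Ω} (hT : MeasurePreserving T μ μ)
    {G : Type*} [NormedAddCommGroup G] [NormedSpace ℝ G] {H : Ω → G}
    (hH : AEStronglyMeasurable H μ) : ∫ ω, H (T ω) ∂μ = ∫ ω, H ω ∂μ := by
  have h := integral_map (μ := μ) (φ := T) hT.measurable.aemeasurable (f := H)
    (by rwa [hT.map_eq])
  rw [← h, hT.map_eq]

namespace IsStationaryMartingaleDifference

variable {Ω : Type*} {mΩ : MeasurableSpace Ω} {μ : Measure Ω}
  {T : Ω → Ω} {𝒢 : ℕ → MeasurableSpace Ω} {F : Ω → ℝ}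

theorem memLp_iterate (h : IsStationaryMartingaleDifference μ T 𝒢 F) (k : ℕ) :
    MemLp (fun ω => F (T^[k] ω)) 2 μ :=
  h.memLp.comp_measurePreserving (h.measurePreserving.iterate k)

theorem memLp_sum (h : IsStationaryMartingaleDifference μ T 𝒢 F) (r : ℕ → ℕ) (s : Finset ℕ) :
    MemLp (fun ω => ∑ j ∈ s, F (T^[r j] ω)) 2 μ :=
  memLp_finsetSum s fun j _ => h.memLp_iterate (r j)

theorem aestronglyMeasurable_of_le (h : IsStationaryMartingaleDifference μ T 𝒢 F) {j k : ℕ}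
    (hjk : j ≤ k) : AEStronglyMeasurable[𝒢 k] (fun ω => F (T^[j] ω)) μ :=
  (h.aestronglyMeasurable j).mono (h.mono hjk)

theorem aestronglyMeasurable_sum (h : IsStationaryMartingaleDifference μ T 𝒢 F) (k : ℕ) :
    AEStronglyMeasurable[𝒢 k] (fun ω => ∑ j ∈ Finset.range k, F (T^[j + 1] ω)) μ := by
  refine aestronglyMeasurable_sum_of_sub_measurableSpace _ fun j hj => ?_
  exact h.aestronglyMeasurable_of_le (Finset.mem_range.1 hj)

theorem integral_mul_eq_zero [IsFiniteMeasure μ]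
    (h : IsStationaryMartingaleDifference μ T 𝒢 F) {k j : ℕ}
    (hkj : k < j) {Z : Ω → ℂ} (hZ : AEStronglyMeasurable[𝒢 k] Z μ)
    (hZF : Integrable (fun ω => Z ω * (F (T^[j] ω) : ℂ)) μ) :
    ∫ ω, Z ω * (F (T^[j] ω) : ℂ) ∂μ = 0 :=
  integral_mul_ofReal_eq_zero_of_forall_setIntegral_eq_zero (h.le k) hZ
    ((h.memLp_iterate j).integrable (by norm_num)) hZF (h.setIntegral_eq_zero k j hkj)

theorem integral_cexp_mul_sum_eq_zero [IsFiniteMeasure μ]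
    (h : IsStationaryMartingaleDifference μ T 𝒢 F) (k m : ℕ)
    {W : Ω → ℝ} (hW : AEStronglyMeasurable[𝒢 k] W μ) :
    ∫ ω, Complex.exp ((W ω : ℂ) * Complex.I) *
      ((∑ u ∈ Finset.range m, F (T^[k + u + 1] ω) : ℝ) : ℂ) ∂μ = 0 := by
  have hW' := hW.mono (h.le k)
  push_cast
  simp_rw [Finset.mul_sum]
  have hi : ∀ u, Integrable (fun ω => Complex.exp ((W ω : ℂ) * Complex.I) *
      (F (T^[k + u + 1] ω) : ℂ)) μ := fun u =>
    integrable_cexp_mul_I_mul hW' ((h.memLp_iterate _).integrable (by norm_num))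
  rw [integral_finsetSum _ fun u _ => hi u]
  refine Finset.sum_eq_zero fun u _ => ?_
  exact h.integral_mul_eq_zero (k := k) (by omega) (aestronglyMeasurable_cexp_mul_I hW) (hi u)

/-- The off-diagonal products vanish: `exp (iW)` times the earlier terms of the block is measurable
with respect to the past of the last term. Thus conditional variances of block sums reduce to sums
of squares. -/
theorem integral_cexp_mul_sq_sum [IsFiniteMeasure μ]
    (h : IsStationaryMartingaleDifference μ T 𝒢 F) (k m : ℕ)
    {W : Ω → ℝ} (hW : AEStronglyMeasurable[𝒢 k] W μ) :
    ∫ ω, Complex.exp ((W ω : ℂ) * Complex.I) *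
      (((∑ u ∈ Finset.range m, F (T^[k + u + 1] ω)) ^ 2 : ℝ) : ℂ) ∂μ =
    ∫ ω, Complex.exp ((W ω : ℂ) * Complex.I) *
      ((∑ u ∈ Finset.range m, F (T^[k + u + 1] ω) ^ 2 : ℝ) : ℂ) ∂μ := by
  have hW' := hW.mono (h.le k)
  induction m with
  | zero => simp
  | succ m ih =>
    set S : Ω → ℝ := fun ω => ∑ u ∈ Finset.range m, F (T^[k + u + 1] ω) with hS
    have hS2 : MemLp S 2 μ := h.memLp_sum (fun u => k + u + 1) _
    have hFm := h.memLp_iterate (k + m + 1)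
    have hsq : Integrable (fun ω => S ω ^ 2) μ := hS2.integrable_sq
    have hmul : Integrable (fun ω => S ω * F (T^[k + m + 1] ω)) μ := hS2.integrable_mul hFm
    have hsum : Integrable (fun ω => ∑ u ∈ Finset.range m, F (T^[k + u + 1] ω) ^ 2) μ :=
      integrable_finsetSum _ fun u _ => (h.memLp_iterate _).integrable_sq
    have e1 : ∀ ω, Complex.exp ((W ω : ℂ) * Complex.I) *
        (((∑ u ∈ Finset.range (m + 1), F (T^[k + u + 1] ω)) ^ 2 : ℝ) : ℂ)
        = Complex.exp ((W ω : ℂ) * Complex.I) * ((S ω ^ 2 : ℝ) : ℂ)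
          + 2 * (Complex.exp ((W ω : ℂ) * Complex.I) * ((S ω * F (T^[k + m + 1] ω) : ℝ) : ℂ))
          + Complex.exp ((W ω : ℂ) * Complex.I) * ((F (T^[k + m + 1] ω) ^ 2 : ℝ) : ℂ) := by
      intro ω
      rw [Finset.sum_range_succ, ← show S ω = ∑ u ∈ Finset.range m, F (T^[k + u + 1] ω) from rfl]
      push_cast
      ring
    have e2 : ∀ ω, Complex.exp ((W ω : ℂ) * Complex.I) *
        ((∑ u ∈ Finset.range (m + 1), F (T^[k + u + 1] ω) ^ 2 : ℝ) : ℂ)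
        = Complex.exp ((W ω : ℂ) * Complex.I) *
          ((∑ u ∈ Finset.range m, F (T^[k + u + 1] ω) ^ 2 : ℝ) : ℂ)
          + Complex.exp ((W ω : ℂ) * Complex.I) * ((F (T^[k + m + 1] ω) ^ 2 : ℝ) : ℂ) := by
      intro ω
      rw [Finset.sum_range_succ]
      push_cast
      ring
    have i1 := integrable_cexp_mul_I_mul hW' hsq
    have i2 := integrable_cexp_mul_I_mul hW' hmul
    have i3 := integrable_cexp_mul_I_mul hW' hFm.integrable_sq
    have i4 := integrable_cexp_mul_I_mul hW' hsum
    have hz : ∫ ω, Complex.exp ((W ω : ℂ) * Complex.I) *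
        ((S ω * F (T^[k + m + 1] ω) : ℝ) : ℂ) ∂μ = 0 := by
      have e3 : ∀ ω, Complex.exp ((W ω : ℂ) * Complex.I) * ((S ω * F (T^[k + m + 1] ω) : ℝ) : ℂ)
          = (Complex.exp ((W ω : ℂ) * Complex.I) * (S ω : ℂ)) * (F (T^[k + m + 1] ω) : ℂ) := by
        intro ω; push_cast; ring
      simp_rw [e3] at i2 ⊢
      refine h.integral_mul_eq_zero (k := k + m) (by omega) ?_ i2
      refine (aestronglyMeasurable_cexp_mul_I (hW.mono (h.mono (by omega)))).mul ?_
      refine Complex.continuous_ofReal.comp_aestronglyMeasurable ?_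
      refine aestronglyMeasurable_sum_of_sub_measurableSpace _ fun u hu => ?_
      refine h.aestronglyMeasurable_of_le ?_
      have := Finset.mem_range.1 hu
      omega
    simp_rw [e1, e2]
    rw [integral_add (i1.fun_add (i2.const_mul 2)) i3, integral_add i1 (i2.const_mul 2),
      integral_const_mul, hz, integral_add i4 i3, ← ih, mul_zero, add_zero]

end IsStationaryMartingaleDifference

/-! ### Block sums: second moments and characteristic functions -/

namespace IsStationaryMartingaleDifference

variable {Ω : Type*} {mΩ : MeasurableSpace Ω} {μ : Measure Ω}
  {T : Ω → Ω} {𝒢 : ℕ → MeasurableSpace Ω} {F : Ω → ℝ}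

theorem integral_sq_iterate (h : IsStationaryMartingaleDifference μ T 𝒢 F) (k : ℕ) :
    ∫ ω, F (T^[k] ω) ^ 2 ∂μ = ∫ ω, F ω ^ 2 ∂μ :=
  (h.measurePreserving.iterate k).integral_comp_aestronglyMeasurable (H := fun ω => F ω ^ 2)
    (h.memLp.1.pow 2)

theorem integral_sq_sum_succ [IsProbabilityMeasure μ]
    (h : IsStationaryMartingaleDifference μ T 𝒢 F) (k m : ℕ) :
    ∫ ω, (∑ u ∈ Finset.range m, F (T^[k + u + 1] ω)) ^ 2 ∂μ = m * ∫ ω, F ω ^ 2 ∂μ := by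
  -- With `W = 0` the identity is plain orthogonality of the increments.
  have h1 := h.integral_cexp_mul_sq_sum k m (W := fun _ => 0) aestronglyMeasurable_const
  simp only [Complex.ofReal_zero, zero_mul, Complex.exp_zero, one_mul] at h1
  rw [integral_complex_ofReal, integral_complex_ofReal] at h1
  rw [Complex.ofReal_injective h1, integral_finsetSum _ fun u _ => (h.memLp_iterate _).integrable_sq]
  simp_rw [h.integral_sq_iterate]
  simp

theorem integral_sq_sum [IsProbabilityMeasure μ]
    (h : IsStationaryMartingaleDifference μ T 𝒢 F) (m : ℕ) :
    ∫ ω, (∑ u ∈ Finset.range m, F (T^[u] ω)) ^ 2 ∂μ = m * ∫ ω, F ω ^ 2 ∂μ := by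
  rw [← h.integral_sq_sum_succ 0 m, ← h.measurePreserving.integral_comp_aestronglyMeasurable
    (H := fun ω => (∑ u ∈ Finset.range m, F (T^[u] ω)) ^ 2)
    ((h.memLp_sum (fun u => u) _).1.pow 2)]
  simp only [zero_add, Function.iterate_succ_apply]

theorem integral_comp_block (h : IsStationaryMartingaleDifference μ T 𝒢 F) (k : ℕ)
    {Φ : (ℕ → ℝ) → ℝ}
    (hΦ : AEStronglyMeasurable (fun ω => Φ (fun u => F (T^[u] ω))) μ) :
    ∫ ω, Φ (fun u => F (T^[k + u + 1] ω)) ∂μ = ∫ ω, Φ (fun u => F (T^[u] ω)) ∂μ := by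
  rw [← (h.measurePreserving.iterate (k + 1)).integral_comp_aestronglyMeasurable hΦ]
  simp only [← Function.iterate_add_apply]
  congr! 6
  omega

/-- The characteristic function estimate for one block of length `m`. -/
theorem norm_integral_cexp_block_le [IsProbabilityMeasure μ]
    (h : IsStationaryMartingaleDifference μ T 𝒢 F) (k m : ℕ)
    (a : ℝ) {L σ2 : ℝ} (hL : 0 ≤ L) (hσ : ∫ ω, F ω ^ 2 ∂μ = σ2) :
    ‖(∫ ω, Complex.exp (((a * ∑ j ∈ Finset.range (k + m), F (T^[j + 1] ω) : ℝ) : ℂ)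
          * Complex.I) ∂μ)
        - (Real.exp (-(a ^ 2 * m * σ2 / 2)) : ℂ) *
          ∫ ω, Complex.exp (((a * ∑ j ∈ Finset.range k, F (T^[j + 1] ω) : ℝ) : ℂ)
            * Complex.I) ∂μ‖
      ≤ a ^ 2 / 2 * (∫ ω, |∑ u ∈ Finset.range m, F (T^[u] ω) ^ 2 - m * σ2| ∂μ)
        + 4 * a ^ 2 * (2 * (∫ ω, ((∑ u ∈ Finset.range m, F (T^[u] ω)) ^ 2
            - min ((∑ u ∈ Finset.range m, F (T^[u] ω)) ^ 2) L) ∂μ)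
          + |a| * √(2 * L) * (m * σ2))
        + (a ^ 2 * m * σ2) ^ 2 / 4 := by
  have hσ0 : 0 ≤ σ2 := hσ ▸ integral_nonneg fun ω => sq_nonneg _
  set W : Ω → ℝ := fun ω => a * ∑ j ∈ Finset.range k, F (T^[j + 1] ω) with hWdef
  set G : Ω → ℝ := fun ω => ∑ u ∈ Finset.range m, F (T^[k + u + 1] ω) with hG
  have hWm : AEStronglyMeasurable[𝒢 k] W μ := (h.aestronglyMeasurable_sum k).const_mul a
  have hG2 : MemLp G 2 μ := h.memLp_sum (fun u => k + u + 1) _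
  have hGsq : Integrable (fun ω => G ω ^ 2) μ := hG2.integrable_sq
  have hsplit : ∀ ω, a * ∑ j ∈ Finset.range (k + m), F (T^[j + 1] ω) = W ω + a * G ω := by
    intro ω; simp only [hWdef, hG]; rw [Finset.sum_range_add, mul_add]
  have hGmin : Integrable (fun ω => G ω ^ 2 - min (G ω ^ 2) L) μ := by
    refine hGsq.sub' (hGsq.mono' ?_ (Eventually.of_forall fun ω => ?_))
    · have : Continuous (fun x : ℝ => min (x ^ 2) L) := by fun_prop
      exact this.comp_aestronglyMeasurable hG2.1
    · rw [Real.norm_of_nonneg (by positivity)]; exact min_le_left _ _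
  have hsum : Integrable (fun ω => ∑ u ∈ Finset.range m, F (T^[k + u + 1] ω) ^ 2) μ :=
    integrable_finsetSum _ fun u _ => (h.memLp_iterate _).integrable_sq
  simp_rw [hsplit]
  have h1 : ∫ ω, Complex.exp ((W ω : ℂ) * Complex.I) * ((a * G ω : ℝ) : ℂ) ∂μ = 0 := by
    have := h.integral_cexp_mul_sum_eq_zero k m hWm
    calc _ = ∫ ω, (a : ℂ) * (Complex.exp ((W ω : ℂ) * Complex.I) * ((G ω : ℝ) : ℂ)) ∂μ := by
          congr 1; ext ω; push_cast; ring
      _ = 0 := by rw [integral_const_mul, this, mul_zero]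
  have hW' := hWm.mono (h.le k)
  -- After the cross terms are removed, the phase has modulus one and can be dropped; stationarity
  -- then moves the block to the origin, so the bound does not depend on `k`.
  have h2 : ‖∫ ω, Complex.exp ((W ω : ℂ) * Complex.I) *
      (((a * G ω) ^ 2 - a ^ 2 * m * σ2 : ℝ) : ℂ) ∂μ‖
      ≤ a ^ 2 * (∫ ω, |∑ u ∈ Finset.range m, F (T^[u] ω) ^ 2 - m * σ2| ∂μ) := by
    have e1 : ∫ ω, Complex.exp ((W ω : ℂ) * Complex.I) *
        (((a * G ω) ^ 2 - a ^ 2 * m * σ2 : ℝ) : ℂ) ∂μ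
        = (a ^ 2 : ℂ) * ∫ ω, Complex.exp ((W ω : ℂ) * Complex.I) *
          ((∑ u ∈ Finset.range m, F (T^[k + u + 1] ω) ^ 2 - m * σ2 : ℝ) : ℂ) ∂μ := by
      have e2 : ∀ ω, Complex.exp ((W ω : ℂ) * Complex.I) *
          (((a * G ω) ^ 2 - a ^ 2 * m * σ2 : ℝ) : ℂ)
          = (a ^ 2 : ℂ) * (Complex.exp ((W ω : ℂ) * Complex.I) * ((G ω ^ 2 : ℝ) : ℂ)
            - Complex.exp ((W ω : ℂ) * Complex.I) * ((m * σ2 : ℝ) : ℂ)) := by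
        intro ω; push_cast; ring
      have e3 : ∀ ω, Complex.exp ((W ω : ℂ) * Complex.I) *
          ((∑ u ∈ Finset.range m, F (T^[k + u + 1] ω) ^ 2 - m * σ2 : ℝ) : ℂ)
          = Complex.exp ((W ω : ℂ) * Complex.I) *
              ((∑ u ∈ Finset.range m, F (T^[k + u + 1] ω) ^ 2 : ℝ) : ℂ)
            - Complex.exp ((W ω : ℂ) * Complex.I) * ((m * σ2 : ℝ) : ℂ) := by
        intro ω; push_cast; ring
      have i3 := integrable_cexp_mul_I_mul (X := fun _ => (m * σ2 : ℝ)) hW'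
        (integrable_const _)
      simp_rw [e2, e3]
      rw [integral_const_mul, integral_sub (integrable_cexp_mul_I_mul hW' hGsq) i3,
        integral_sub (integrable_cexp_mul_I_mul hW' hsum) i3, h.integral_cexp_mul_sq_sum k m hWm]
    rw [e1, norm_mul, show ‖(a ^ 2 : ℂ)‖ = a ^ 2 by simp]
    refine mul_le_mul_of_nonneg_left (norm_integral_cexp_mul_I_mul_le.trans (le_of_eq ?_))
      (sq_nonneg a)
    refine h.integral_comp_block k (Φ := fun x => |∑ u ∈ Finset.range m, x u ^ 2 - m * σ2|) ?_
    have h0 : Integrable (fun ω => ∑ u ∈ Finset.range m, F (T^[u] ω) ^ 2) μ :=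
      integrable_finsetSum _ fun u _ => (h.memLp_iterate _).integrable_sq
    exact (h0.sub (integrable_const _)).abs.1
  have h3 := norm_integral_cexp_add_sub_le (by positivity) hW' (hG2.const_mul a) h1 h2
  have h4 : ∫ ω, min ((a * G ω) ^ 2) (|a * G ω| ^ 3) ∂μ
      ≤ a ^ 2 * (2 * (∫ ω, ((∑ u ∈ Finset.range m, F (T^[u] ω)) ^ 2
            - min ((∑ u ∈ Finset.range m, F (T^[u] ω)) ^ 2) L) ∂μ)
          + |a| * √(2 * L) * (m * σ2)) := by
    have e1 : ∫ ω, ((∑ u ∈ Finset.range m, F (T^[u] ω)) ^ 2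
            - min ((∑ u ∈ Finset.range m, F (T^[u] ω)) ^ 2) L) ∂μ
        = ∫ ω, (G ω ^ 2 - min (G ω ^ 2) L) ∂μ := by
      refine (h.integral_comp_block k (Φ := fun x => (∑ u ∈ Finset.range m, x u) ^ 2
        - min ((∑ u ∈ Finset.range m, x u) ^ 2) L) ?_).symm
      have : Continuous (fun x : ℝ => x ^ 2 - min (x ^ 2) L) := by fun_prop
      exact this.comp_aestronglyMeasurable (h.memLp_sum (fun u => u) _).1
    have e2 : (m * σ2 : ℝ) = ∫ ω, G ω ^ 2 ∂μ := by rw [← hσ]; exact (h.integral_sq_sum_succ k m).symm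
    rw [e1, e2, mul_add, ← integral_const_mul, ← integral_const_mul, ← integral_const_mul,
      ← integral_const_mul, ← integral_add ((hGmin.const_mul _).const_mul _)
        ((hGsq.const_mul _).const_mul _)]
    refine integral_mono_of_nonneg (Eventually.of_forall fun ω => by positivity)
      (((hGmin.const_mul _).const_mul _).add ((hGsq.const_mul _).const_mul _))
      (Eventually.of_forall fun ω => min_sq_cube_le hL)
  refine h3.trans ?_
  linarith

/-- Telescoping over the blocks: the factors `exp (-c/2)` are at most `1`, so errors of earlier
blocks are not amplified and simply add. -/
theorem norm_integral_cexp_blocks_le [IsProbabilityMeasure μ]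
    (h : IsStationaryMartingaleDifference μ T 𝒢 F) (m : ℕ)
    (a : ℝ) {L σ2 : ℝ} (hL : 0 ≤ L) (hσ : ∫ ω, F ω ^ 2 ∂μ = σ2) (K : ℕ) :
    ‖(∫ ω, Complex.exp (((a * ∑ j ∈ Finset.range (K * m), F (T^[j + 1] ω) : ℝ) : ℂ)
          * Complex.I) ∂μ)
        - (Real.exp (-(K * (a ^ 2 * m * σ2) / 2)) : ℂ)‖
      ≤ K * (a ^ 2 / 2 * (∫ ω, |∑ u ∈ Finset.range m, F (T^[u] ω) ^ 2 - m * σ2| ∂μ)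
        + 4 * a ^ 2 * (2 * (∫ ω, ((∑ u ∈ Finset.range m, F (T^[u] ω)) ^ 2
            - min ((∑ u ∈ Finset.range m, F (T^[u] ω)) ^ 2) L) ∂μ)
          + |a| * √(2 * L) * (m * σ2))
        + (a ^ 2 * m * σ2) ^ 2 / 4) := by
  have hσ0 : 0 ≤ σ2 := hσ ▸ integral_nonneg fun ω => sq_nonneg _
  induction K with
  | zero => simp
  | succ K ih =>
    have hstep := h.norm_integral_cexp_block_le (K * m) m a hL hσ
    rw [← Nat.succ_mul] at hstep
    set c : ℝ := a ^ 2 * m * σ2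
    have hc : 0 ≤ c := by positivity
    have hexp : (Real.exp (-(((K + 1 : ℕ) : ℝ) * c / 2)) : ℂ)
        = (Real.exp (-(c / 2)) : ℂ) * (Real.exp (-(K * c / 2)) : ℂ) := by
      rw [← Complex.ofReal_mul, ← Real.exp_add]
      congr 2; push_cast; ring
    have hle : ‖(Real.exp (-(c / 2)) : ℂ)‖ ≤ 1 := by
      rw [Complex.norm_real, Real.norm_of_nonneg (Real.exp_pos _).le]
      exact Real.exp_le_one_iff.2 (by linarith)
    rw [hexp]
    have key : ∀ A B e x : ℂ, A - e * x = (A - e * B) + e * (B - x) := by intros; ring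
    rw [key _ (∫ ω, Complex.exp (((a * ∑ j ∈ Finset.range (K * m), F (T^[j + 1] ω) : ℝ) : ℂ)
          * Complex.I) ∂μ)]
    refine (norm_add_le _ _).trans ?_
    rw [norm_mul, Nat.cast_succ, add_mul (K : ℝ), one_mul, add_comm]
    refine add_le_add ?_ hstep
    refine (mul_le_mul hle ih (norm_nonneg _) zero_le_one).trans (by rw [one_mul])

/-- Disposes of the incomplete last block: `|exp (ix) - 1| ≤ |x|`, and the `L¹` norm of the extra
terms is at most their `L²` norm, computed by orthogonality. -/
theorem norm_integral_cexp_sub_le [IsProbabilityMeasure μ]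
    (h : IsStationaryMartingaleDifference μ T 𝒢 F) (k r : ℕ)
    (a : ℝ) :
    ‖(∫ ω, Complex.exp (((a * ∑ j ∈ Finset.range (k + r), F (T^[j + 1] ω) : ℝ) : ℂ)
          * Complex.I) ∂μ)
        - ∫ ω, Complex.exp (((a * ∑ j ∈ Finset.range k, F (T^[j + 1] ω) : ℝ) : ℂ)
          * Complex.I) ∂μ‖
      ≤ |a| * √(r * ∫ ω, F ω ^ 2 ∂μ) := by
  have hS : ∀ k, AEStronglyMeasurable
      (fun ω => a * ∑ j ∈ Finset.range k, F (T^[j + 1] ω)) μ := fun k =>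
    ((h.memLp_sum (fun j => j + 1) (Finset.range k)).const_mul a).1
  set R : Ω → ℝ := fun ω => ∑ u ∈ Finset.range r, F (T^[k + u + 1] ω) with hR
  have hR2 : MemLp R 2 μ := h.memLp_sum (fun u => k + u + 1) _
  have hR1 : Integrable R μ := hR2.integrable (by norm_num)
  rw [← integral_sub (integrable_cexp_mul_I (hS _)) (integrable_cexp_mul_I (hS _))]
  have h1 : ∫ ω, |R ω| ∂μ ≤ √(r * ∫ ω, F ω ^ 2 ∂μ) := by
    refine Real.le_sqrt_of_sq_le ?_
    rw [← h.integral_sq_sum_succ k r]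
    exact sq_integral_abs_le hR2
  refine le_trans ?_ (mul_le_mul_of_nonneg_left h1 (abs_nonneg a))
  rw [← integral_const_mul]
  refine norm_integral_le_of_norm_le (hR1.abs.const_mul _) (Eventually.of_forall fun ω => ?_)
  rw [Finset.sum_range_add, mul_add, Complex.ofReal_add, add_mul, Complex.exp_add]
  rw [show ∀ x y : ℂ, x * y - x = x * (y - 1) by intros; ring, norm_mul,
    Complex.norm_exp_ofReal_mul_I, one_mul, ← abs_mul, mul_comm _ Complex.I]
  exact Real.norm_exp_I_mul_ofReal_sub_one_le

theorem norm_integral_cexp_sub_gaussian_le [IsProbabilityMeasure μ]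
    (h : IsStationaryMartingaleDifference μ T 𝒢 F) {m n : ℕ}
    (hm : 0 < m) (hn : 0 < n) (t : ℝ) {L σ2 δ : ℝ} (hL : 0 ≤ L) (hσ : ∫ ω, F ω ^ 2 ∂μ = σ2)
    (hD : ∫ ω, |∑ u ∈ Finset.range m, F (T^[u] ω) ^ 2 - m * σ2| ∂μ ≤ m * δ)
    (hU : ∫ ω, ((∑ u ∈ Finset.range m, F (T^[u] ω)) ^ 2
            - min ((∑ u ∈ Finset.range m, F (T^[u] ω)) ^ 2) L) ∂μ ≤ δ) :
    ‖(∫ ω, Complex.exp (((t * ((√n)⁻¹ * ∑ j ∈ Finset.range n, F (T^[j + 1] ω)) : ℝ) : ℂ)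
          * Complex.I) ∂μ) - (Real.exp (-(t ^ 2 * σ2 / 2)) : ℂ)‖
      ≤ 9 * t ^ 2 * δ + (4 * |t| ^ 3 * √(2 * L) * σ2 + |t| * √(m * σ2)) * (√n)⁻¹
        + (t ^ 4 * m * σ2 ^ 2 / 4 + t ^ 2 * σ2 * m / 2) * (n : ℝ)⁻¹ := by
  have hσ0 : 0 ≤ σ2 := hσ ▸ integral_nonneg fun ω => sq_nonneg _
  have hδ : 0 ≤ δ := by
    refine le_trans (integral_nonneg fun ω => ?_) hU
    exact sub_nonneg.2 (min_le_left _ _)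
  set a : ℝ := t * (√n)⁻¹ with ha
  have hn' : (0 : ℝ) < n := by exact_mod_cast hn
  have hm' : (1 : ℝ) ≤ m := by exact_mod_cast hm
  have ha2 : a ^ 2 = t ^ 2 * (n : ℝ)⁻¹ := by
    rw [ha, mul_pow, inv_pow, Real.sq_sqrt hn'.le]
  have haabs : |a| = |t| * (√n)⁻¹ := by rw [ha, abs_mul, abs_of_nonneg (a := (√n)⁻¹) (by positivity)]
  simp_rw [← mul_assoc, ← ha]
  obtain ⟨K, r, hr, hnK⟩ : ∃ K r, r < m ∧ n = K * m + r :=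
    ⟨n / m, n % m, Nat.mod_lt _ hm, by rw [mul_comm]; exact (Nat.div_add_mod n m).symm⟩
  have hnK' : (n : ℝ) = K * m + r := by exact_mod_cast hnK
  have hr' : (r : ℝ) ≤ m := by exact_mod_cast hr.le
  have hr0 : (0 : ℝ) ≤ r := Nat.cast_nonneg r
  have b1 := h.norm_integral_cexp_sub_le (K * m) r a
  have b2 := h.norm_integral_cexp_blocks_le m a hL hσ K
  rw [← hnK, hσ] at b1
  have hKm : (K : ℝ) * m * (n : ℝ)⁻¹ ≤ 1 := by
    rw [← div_eq_mul_inv, div_le_one hn']; linarith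
  have hK : (K : ℝ) * (n : ℝ)⁻¹ ≤ 1 := by
    refine le_trans ?_ hKm
    gcongr
    exact le_mul_of_one_le_right (Nat.cast_nonneg K) hm'
  have b3 : ‖(Real.exp (-(K * (a ^ 2 * m * σ2) / 2)) : ℂ) - (Real.exp (-(t ^ 2 * σ2 / 2)) : ℂ)‖
      ≤ t ^ 2 * σ2 * m / 2 * (n : ℝ)⁻¹ := by
    rw [← Complex.ofReal_sub, Complex.norm_real, Real.norm_eq_abs]
    have e : K * (a ^ 2 * m * σ2) / 2 = t ^ 2 * σ2 / 2 * (K * m * (n : ℝ)⁻¹) := by rw [ha2]; ring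
    refine (abs_exp_neg_sub_exp_neg_le (by positivity) ?_).trans ?_
    · rw [e]; exact mul_le_of_le_one_right (by positivity) hKm
    · rw [e]
      have e2 : 1 - K * m * (n : ℝ)⁻¹ = r * (n : ℝ)⁻¹ := by
        rw [show (1 : ℝ) = n * (n : ℝ)⁻¹ from (mul_inv_cancel₀ hn'.ne').symm]
        rw [show (n : ℝ) * (n : ℝ)⁻¹ - K * m * (n : ℝ)⁻¹ = (n - K * m) * (n : ℝ)⁻¹ by ring, hnK']
        ring
      calc t ^ 2 * σ2 / 2 - t ^ 2 * σ2 / 2 * (K * m * (n : ℝ)⁻¹)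
          = t ^ 2 * σ2 / 2 * (1 - K * m * (n : ℝ)⁻¹) := by ring
        _ = t ^ 2 * σ2 / 2 * (r * (n : ℝ)⁻¹) := by rw [e2]
        _ ≤ t ^ 2 * σ2 / 2 * (m * (n : ℝ)⁻¹) := by gcongr
        _ = _ := by ring
  have b1' : |a| * √(r * σ2) ≤ |t| * √(m * σ2) * (√n)⁻¹ := by
    rw [haabs]
    calc |t| * (√n)⁻¹ * √(r * σ2) ≤ |t| * (√n)⁻¹ * √(m * σ2) := by gcongr
      _ = _ := by ring
  have b2' : K * (a ^ 2 / 2 * (∫ ω, |∑ u ∈ Finset.range m, F (T^[u] ω) ^ 2 - m * σ2| ∂μ)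
        + 4 * a ^ 2 * (2 * (∫ ω, ((∑ u ∈ Finset.range m, F (T^[u] ω)) ^ 2
            - min ((∑ u ∈ Finset.range m, F (T^[u] ω)) ^ 2) L) ∂μ)
          + |a| * √(2 * L) * (m * σ2))
        + (a ^ 2 * m * σ2) ^ 2 / 4)
      ≤ 9 * t ^ 2 * δ + 4 * |t| ^ 3 * √(2 * L) * σ2 * (√n)⁻¹
        + t ^ 4 * m * σ2 ^ 2 / 4 * (n : ℝ)⁻¹ := by
    -- Since `a² = t²/n` and `K m ≤ n`, the squares contribute `t² δ / 2` and the tail `8 t² δ`; the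
    -- sum is rounded up to `9 t² δ`. Everything else carries a negative power of `n`.
    calc _ ≤ K * (a ^ 2 / 2 * (m * δ) + 4 * a ^ 2 * (2 * δ + |a| * √(2 * L) * (m * σ2))
        + (a ^ 2 * m * σ2) ^ 2 / 4) := by gcongr
      _ = (K * m * (n : ℝ)⁻¹) * (t ^ 2 / 2 * δ) + (K * (n : ℝ)⁻¹) * (8 * t ^ 2 * δ)
          + (K * m * (n : ℝ)⁻¹) * (4 * t ^ 2 * (|a| * √(2 * L) * σ2))
          + (K * m * (n : ℝ)⁻¹) * (t ^ 4 * m * σ2 ^ 2 / 4 * (n : ℝ)⁻¹) := by rw [ha2]; ring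
      _ ≤ 1 * (t ^ 2 / 2 * δ) + 1 * (8 * t ^ 2 * δ) + 1 * (4 * t ^ 2 * (|a| * √(2 * L) * σ2))
          + 1 * (t ^ 4 * m * σ2 ^ 2 / 4 * (n : ℝ)⁻¹) := by gcongr
      _ ≤ _ := by
        rw [haabs, show |t| ^ 3 = t ^ 2 * |t| by rw [pow_succ, sq_abs]]
        nlinarith [mul_nonneg (sq_nonneg t) hδ]
  have key : ∀ A B C D : ℂ, ‖A - D‖ ≤ ‖A - B‖ + ‖B - C‖ + ‖C - D‖ := by
    intro A B C D
    refine (norm_sub_le_norm_sub_add_norm_sub A C D).trans ?_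
    gcongr
    exact norm_sub_le_norm_sub_add_norm_sub A B C
  refine (key _ _ _ _).trans ((add_le_add (add_le_add b1 b2) b3).trans ?_)
  linarith

end IsStationaryMartingaleDifference

/-- A central limit theorem for arrays of stationary martingale differences `F i ∘ T^j`, `j ≤ ν i`:
it is enough that the squares in long blocks have averages close to `σ2`, and that the squares of
block sums are uniformly integrable. -/
theorem tendsto_integral_cexp_of_blocks {Ω ι : Type*} {mΩ : MeasurableSpace Ω} {μ : Measure Ω}
    [IsProbabilityMeasure μ] {T : Ω → Ω} {l : Filter ι} {ν : ι → ℕ} (hν : Tendsto ν l atTop)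
    {𝒢 : ι → ℕ → MeasurableSpace Ω} {F : ι → Ω → ℝ} {σ2 : ℝ}
    (hF : ∀ i, IsStationaryMartingaleDifference μ T (𝒢 i) (F i))
    (hσ : ∀ᶠ i in l, ∫ ω, F i ω ^ 2 ∂μ = σ2)
    (hblock : ∀ δ > 0, ∃ m > 0,
      (∀ᶠ i in l, ∫ ω, |∑ u ∈ Finset.range m, F i (T^[u] ω) ^ 2 - m * σ2| ∂μ ≤ m * δ) ∧
      ∃ L ≥ 0, ∀ᶠ i in l, ∫ ω, ((∑ u ∈ Finset.range m, F i (T^[u] ω)) ^ 2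
            - min ((∑ u ∈ Finset.range m, F i (T^[u] ω)) ^ 2) L) ∂μ ≤ δ) (t : ℝ) :
    Tendsto (fun i => ∫ ω, Complex.exp
      (((t * ((√(ν i))⁻¹ * ∑ j ∈ Finset.range (ν i), F i (T^[j + 1] ω)) : ℝ) : ℂ) * Complex.I) ∂μ)
      l (𝓝 (Real.exp (-(t ^ 2 * σ2 / 2)) : ℂ)) := by
  rw [Metric.tendsto_nhds]
  intro ε hε
  -- Chosen so that `9 t² δ ≤ ε / 2`. It fixes `m` and `L`, and only then does `ν i` grow to make
  -- the remaining terms smaller than `ε / 2`.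
  have hδ : 0 < ε / (18 * (t ^ 2 + 1)) := by positivity
  obtain ⟨m, hm, hD, L, hL, hU⟩ := hblock _ hδ
  have hlim : Tendsto (fun i => (4 * |t| ^ 3 * √(2 * L) * σ2 + |t| * √(m * σ2)) * (√(ν i))⁻¹
        + (t ^ 4 * m * σ2 ^ 2 / 4 + t ^ 2 * σ2 * m / 2) * (ν i : ℝ)⁻¹) l (𝓝 0) := by
    have h1 : Tendsto (fun i => (ν i : ℝ)) l atTop := tendsto_natCast_atTop_atTop.comp hν
    have h2 := (tendsto_inv_atTop_zero.comp h1).const_mul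
      (t ^ 4 * m * σ2 ^ 2 / 4 + t ^ 2 * σ2 * m / 2)
    have h3 := (tendsto_inv_atTop_zero.comp (Real.tendsto_sqrt_atTop.comp h1)).const_mul
      (4 * |t| ^ 3 * √(2 * L) * σ2 + |t| * √(m * σ2))
    simpa using h3.add h2
  filter_upwards [hD, hU, hσ, hν.eventually_gt_atTop 0,
    hlim.eventually (gt_mem_nhds (half_pos hε))] with i hD hU hσ hn hl
  rw [dist_eq_norm]
  refine ((hF i).norm_integral_cexp_sub_gaussian_le hm hn t hL hσ hD hU).trans_lt ?_
  have : 9 * t ^ 2 * (ε / (18 * (t ^ 2 + 1))) ≤ ε / 2 := by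
    rw [mul_div_assoc', div_le_iff₀ (by positivity)]
    nlinarith
  linarith

/-! ### Block conditions from joint asymptotic normality -/

/-- Lévy's convergence theorem along countably generated filters. -/
theorem tendsto_probabilityMeasure_of_tendsto_charFun {ι E : Type*} [NormedAddCommGroup E]
    [InnerProductSpace ℝ E] [FiniteDimensional ℝ E] [MeasurableSpace E] [BorelSpace E]
    {l : Filter ι} [l.IsCountablyGenerated] {P : ι → ProbabilityMeasure E}
    {P₀ : ProbabilityMeasure E}
    (h : ∀ t, Tendsto (fun i => charFun (P i : Measure E) t) l (𝓝 (charFun (P₀ : Measure E) t))) :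
    Tendsto P l (𝓝 P₀) := by
  rw [tendsto_iff_seq_tendsto]
  intro x hx
  exact ProbabilityMeasure.tendsto_iff_tendsto_charFun.2 fun t => (h t).comp hx

theorem tendsto_integral_comp_of_tendsto_charFun {Ω ι E : Type*} {mΩ : MeasurableSpace Ω}
    {μ : Measure Ω} [IsProbabilityMeasure μ] [NormedAddCommGroup E] [InnerProductSpace ℝ E]
    [FiniteDimensional ℝ E] [MeasurableSpace E] [BorelSpace E] {l : Filter ι}
    [l.IsCountablyGenerated] {X : ι → Ω → E} (hX : ∀ i, AEMeasurable (X i) μ) {ν : Measure E}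
    [IsProbabilityMeasure ν]
    (h : ∀ t, Tendsto (fun i => charFun (μ.map (X i)) t) l (𝓝 (charFun ν t)))
    {φ : E → ℝ} (hφ : Continuous φ) {C : ℝ} (hC : ∀ x, |φ x| ≤ C) :
    Tendsto (fun i => ∫ ω, φ (X i ω) ∂μ) l (𝓝 (∫ x, φ x ∂ν)) := by
  have : ∀ i, IsProbabilityMeasure (μ.map (X i)) := fun i => Measure.isProbabilityMeasure_map (hX i)
  let P : ι → ProbabilityMeasure E := fun i => ⟨μ.map (X i), this i⟩
  let P₀ : ProbabilityMeasure E := ⟨ν, inferInstance⟩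
  have hlim : Tendsto P l (𝓝 P₀) := tendsto_probabilityMeasure_of_tendsto_charFun h
  have h1 := ProbabilityMeasure.tendsto_iff_forall_integral_tendsto.1 hlim
    (BoundedContinuousFunction.ofNormedAddCommGroup φ hφ C hC)
  refine h1.congr fun i => ?_
  exact integral_map (hX i) hφ.aestronglyMeasurable

theorem sq_integral_abs_sub_le_variance {Ω : Type*} {mΩ : MeasurableSpace Ω} {μ : Measure Ω}
    [IsProbabilityMeasure μ] {X : Ω → ℝ} (hX : MemLp X 2 μ) :
    (∫ ω, |X ω - ∫ ω', X ω' ∂μ| ∂μ) ^ 2 ≤ variance X μ := by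
  rw [variance_eq_integral hX.1.aemeasurable]
  exact sq_integral_abs_le (hX.sub (memLp_const _))

theorem memLp_sq_gaussianReal (v : NNReal) : MemLp (fun x : ℝ => x ^ 2) 2 (gaussianReal 0 v) := by
  have h4 : MemLp (id : ℝ → ℝ) 4 (gaussianReal 0 v) := by
    exact_mod_cast memLp_id_gaussianReal (μ := 0) (v := v) 4
  rw [memLp_two_iff_integrable_sq (by fun_prop)]
  have := h4.integrable_norm_pow (by norm_num)
  simp only [id_eq] at this
  refine this.congr (Eventually.of_forall fun x => ?_)
  simp only [Real.norm_eq_abs]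
  rw [← pow_mul, show (4 : ℕ) = 2 * 2 from rfl, pow_mul, sq_abs, pow_mul]

theorem integral_sq_gaussianReal (v : NNReal) : ∫ x, x ^ 2 ∂(gaussianReal 0 v) = v := by
  have h := variance_id_gaussianReal (μ := 0) (v := v)
  rw [variance_eq_integral aemeasurable_id] at h
  simpa using h

/-- A quantitative law of large numbers: variances add over the product measure, and the `L¹` norm
is bounded by the `L²` norm. The bound is of order `√m`, hence negligible against `m`. -/
theorem integral_abs_sum_sq_sub_pi_gaussianReal_le (v : NNReal) (m : ℕ) :
    ∫ z, |∑ u, z u ^ 2 - m * v| ∂(Measure.pi fun _ : Fin m => gaussianReal 0 v)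
      ≤ √(m * variance (fun x : ℝ => x ^ 2) (gaussianReal 0 v)) := by
  set γ := Measure.pi fun _ : Fin m => gaussianReal 0 v with hγ
  have hmp : ∀ u : Fin m, MeasurePreserving (Function.eval u) γ (gaussianReal 0 v) := fun u =>
    measurePreserving_eval _ u
  have hL : ∀ u : Fin m, MemLp (fun z : Fin m → ℝ => z u ^ 2) 2 γ := fun u =>
    (memLp_sq_gaussianReal v).comp_measurePreserving (hmp u)
  have hint : ∀ u : Fin m, ∫ z, z u ^ 2 ∂γ = v := fun u => by
    rw [← integral_sq_gaussianReal v, ← (hmp u).map_eq, integral_map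
      (hmp u).measurable.aemeasurable (by fun_prop)]
  have hsum : MemLp (fun z : Fin m → ℝ => ∑ u, z u ^ 2) 2 γ := memLp_finsetSum _ fun u _ => hL u
  have hmean : ∫ z, ∑ u, z u ^ 2 ∂γ = m * v := by
    rw [integral_finsetSum _ fun u _ => (hL u).integrable (by norm_num)]
    simp [hint]
  have h1 := sq_integral_abs_sub_le_variance hsum
  rw [hmean] at h1
  refine Real.le_sqrt_of_sq_le (h1.trans (le_of_eq ?_))
  have h2 := variance_sum_pi (ι := Fin m) (μ := fun _ => gaussianReal 0 v)
    (X := fun _ x => x ^ 2) (fun _ => memLp_sq_gaussianReal v)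
  rw [← hγ] at h2
  rw [show (fun z : Fin m → ℝ => ∑ u, z u ^ 2) = ∑ u, fun z : Fin m → ℝ => z u ^ 2 by
    ext z; simp, h2]
  simp

theorem tendsto_integral_min_sq_gaussianReal (v : NNReal) :
    Tendsto (fun n : ℕ => ∫ x, min (x ^ 2) (n : ℝ) ∂(gaussianReal 0 v)) atTop (𝓝 v) := by
  rw [← integral_sq_gaussianReal v]
  refine tendsto_integral_of_dominated_convergence (fun x => x ^ 2)
    (fun n => by fun_prop) ?_ (fun n => Eventually.of_forall fun x => ?_)
    (Eventually.of_forall fun x => ?_)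
  · exact (memLp_sq_gaussianReal v).integrable (by norm_num)
  · rw [Real.norm_of_nonneg (by positivity)]; exact min_le_left _ _
  · refine tendsto_const_nhds.congr' ?_
    filter_upwards [eventually_ge_atTop ⌈x ^ 2⌉₊] with n hn
    exact (min_eq_left ((Nat.le_ceil _).trans (by exact_mod_cast hn))).symm

/-- If the finite-dimensional distributions of `(F i ∘ T^u)_u` are asymptotically those of
independent Gaussian variables, then the block conditions for the central limit theorem hold. -/
theorem exists_block_of_tendsto_joint {Ω ι : Type*} {mΩ : MeasurableSpace Ω} {μ : Measure Ω}
    [IsProbabilityMeasure μ] {T : Ω → Ω} {l : Filter ι} [l.IsCountablyGenerated]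
    {𝒢 : ι → ℕ → MeasurableSpace Ω} {F : ι → Ω → ℝ} {v : NNReal}
    (hF : ∀ i, IsStationaryMartingaleDifference μ T (𝒢 i) (F i))
    (hσ : ∀ᶠ i in l, ∫ ω, F i ω ^ 2 ∂μ = v)
    (hjoint : ∀ (m : ℕ) (a : ℕ → ℝ), Tendsto (fun i => ∫ ω, Complex.exp
      (((∑ u ∈ Finset.range m, a u * F i (T^[u] ω) : ℝ) : ℂ) * Complex.I) ∂μ) l
      (𝓝 (Real.exp (-(v * (∑ u ∈ Finset.range m, a u ^ 2) / 2)) : ℂ)))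
    {δ : ℝ} (hδ : 0 < δ) : ∃ m > 0,
      (∀ᶠ i in l, ∫ ω, |∑ u ∈ Finset.range m, F i (T^[u] ω) ^ 2 - m * v| ∂μ ≤ m * δ) ∧
      ∃ L ≥ (0 : ℝ), ∀ᶠ i in l, ∫ ω, ((∑ u ∈ Finset.range m, F i (T^[u] ω)) ^ 2
            - min ((∑ u ∈ Finset.range m, F i (T^[u] ω)) ^ 2) L) ∂μ ≤ δ := by
  set C : ℝ := variance (fun x : ℝ => x ^ 2) (gaussianReal 0 v) with hC
  have hC0 : 0 ≤ C := variance_nonneg _ _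
  -- This size of `m` gives `√(m C) < m δ / 2`, half of the permitted error.
  obtain ⟨m, hm⟩ := exists_nat_gt (4 * C / δ ^ 2)
  have hm0 : (0 : ℝ) < m := lt_of_le_of_lt (by positivity) hm
  refine ⟨m, by exact_mod_cast hm0, ?_, ?_⟩
  · set X : ι → Ω → EuclideanSpace ℝ (Fin m) :=
      fun i ω => WithLp.toLp 2 (fun u : Fin m => F i (T^[u] ω)) with hXdef
    have hX : ∀ i, AEMeasurable (X i) μ := fun i => by
      refine (WithLp.measurable_toLp 2 _).comp_aemeasurable ?_
      exact aemeasurable_pi_lambda _ fun u => ((hF i).memLp_iterate u).1.aemeasurable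
    set γ := Measure.pi fun _ : Fin m => gaussianReal 0 v with hγ
    set ν : Measure (EuclideanSpace ℝ (Fin m)) := γ.map (WithLp.toLp 2) with hν
    have hνp : IsProbabilityMeasure ν :=
      Measure.isProbabilityMeasure_map (WithLp.measurable_toLp 2 _).aemeasurable
    have hchar : ∀ t, Tendsto (fun i => charFun (μ.map (X i)) t) l (𝓝 (charFun ν t)) := by
      intro t
      have h1 := hjoint m (fun u => if hu : u < m then t ⟨u, hu⟩ else 0)
      have e1 : charFun ν t
          = (Real.exp (-(v * (∑ u ∈ Finset.range m,
            (if hu : u < m then t ⟨u, hu⟩ else 0) ^ 2) / 2)) : ℂ) := by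
        rw [hν, hγ, charFun_pi]
        simp_rw [charFun_gaussianReal]
        rw [← Complex.exp_sum, Complex.ofReal_exp, Finset.sum_range]
        congr 1
        simp only [Fin.is_lt, dite_true, Fin.eta]
        push_cast
        rw [Finset.mul_sum, Finset.sum_div, ← Finset.sum_neg_distrib]
        exact Finset.sum_congr rfl fun u _ => by ring
      rw [e1]
      refine h1.congr fun i => ?_
      rw [charFun_apply, integral_map (hX i) (by fun_prop)]
      congr 1; ext ω
      congr 3
      rw [Finset.sum_range]
      simp [hXdef, PiLp.inner_apply]
    -- Weak convergence cannot be tested on the unbounded function `|∑ x_u² - m v|`. Its negative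
    -- part is continuous and bounded by `m v`; as the variable has mean zero, the absolute moment
    -- is twice that of the negative part.
    have hcont : Continuous (fun x : EuclideanSpace ℝ (Fin m) =>
        max 0 (m * (v : ℝ) - ∑ u, x u ^ 2)) := by fun_prop
    have hlim := tendsto_integral_comp_of_tendsto_charFun hX hchar hcont (C := m * v) (fun x => by
      rw [abs_of_nonneg (le_max_left _ _)]
      refine max_le (by positivity) (sub_le_self _ ?_)
      exact Finset.sum_nonneg fun u _ => sq_nonneg _)
    have hlimle : ∫ x, max 0 (m * (v : ℝ) - ∑ u, x u ^ 2) ∂ν < m * δ / 2 := by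
      have e1 : ∫ x, max 0 (m * (v : ℝ) - ∑ u, x u ^ 2) ∂ν
          = ∫ z, max 0 (m * (v : ℝ) - ∑ u, z u ^ 2) ∂γ := by
        rw [hν, integral_map (WithLp.measurable_toLp 2 _).aemeasurable hcont.aestronglyMeasurable]
      have e2 : ∫ z, max 0 (m * (v : ℝ) - ∑ u, z u ^ 2) ∂γ
          ≤ ∫ z, |∑ u, z u ^ 2 - m * v| ∂γ := by
        refine integral_mono_of_nonneg (Eventually.of_forall fun z => le_max_left _ _) ?_
          (Eventually.of_forall fun z => ?_)
        · refine Integrable.abs (Integrable.sub (integrable_finsetSum _ fun u _ => ?_)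
            (integrable_const _))
          exact ((memLp_sq_gaussianReal v).comp_measurePreserving
            (measurePreserving_eval (fun _ : Fin m => gaussianReal 0 v) u)).integrable (by norm_num)
        · refine max_le (abs_nonneg _) ?_
          exact (le_abs_self _).trans (abs_sub_comm _ _).le
      rw [e1]
      refine (e2.trans (integral_abs_sum_sq_sub_pi_gaussianReal_le v m)).trans_lt ?_
      rw [Real.sqrt_lt' (by positivity), ← hC]
      rw [div_lt_iff₀ (by positivity)] at hm
      nlinarith
    filter_upwards [hlim.eventually (gt_mem_nhds hlimle), hσ] with i hi hσi
    have hsqi : ∀ u : ℕ, Integrable (fun ω => F i (T^[u] ω) ^ 2) μ := fun u =>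
      ((hF i).memLp_iterate u).integrable_sq
    have hsum : Integrable (fun ω => ∑ u ∈ Finset.range m, F i (T^[u] ω) ^ 2 - m * (v : ℝ)) μ :=
      (integrable_finsetSum _ fun u _ => hsqi u).sub (integrable_const _)
    have hzero : ∫ ω, (∑ u ∈ Finset.range m, F i (T^[u] ω) ^ 2 - m * (v : ℝ)) ∂μ = 0 := by
      rw [integral_sub (integrable_finsetSum _ fun u _ => hsqi u) (integrable_const _),
        integral_finsetSum _ fun u _ => hsqi u]
      simp [(hF i).integral_sq_iterate, hσi]
    have habs : ∀ x : ℝ, |x| = 2 * max 0 (-x) + x := by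
      intro x
      rcases le_total 0 x with h | h
      · rw [abs_of_nonneg h, max_eq_left (by linarith)]; ring
      · rw [abs_of_nonpos h, max_eq_right (by linarith)]; ring
    have hmaxi : Integrable (fun ω => max 0 (-(∑ u ∈ Finset.range m, F i (T^[u] ω) ^ 2
        - m * (v : ℝ)))) μ := (integrable_zero _ _ _).sup hsum.neg
    simp_rw [habs]
    rw [integral_add (hmaxi.const_mul 2) hsum, hzero, integral_const_mul, add_zero]
    have e3 : ∫ ω, max 0 (-(∑ u ∈ Finset.range m, F i (T^[u] ω) ^ 2 - m * (v : ℝ))) ∂μ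
        = ∫ ω, max 0 (m * (v : ℝ) - ∑ u, X i ω u ^ 2) ∂μ := by
      congr 1; ext ω
      rw [Finset.sum_range, neg_sub]
    rw [e3]
    linarith
  · set G : ι → Ω → ℝ := fun i ω => ∑ u ∈ Finset.range m, F i (T^[u] ω) with hG
    have hG2 : ∀ i, MemLp (G i) 2 μ := fun i => (hF i).memLp_sum (fun u => u) _
    set w : NNReal := m * v with hw
    have hchar : ∀ t, Tendsto (fun i => charFun (μ.map (G i)) t) l
        (𝓝 (charFun (gaussianReal 0 w) t)) := by
      intro t
      have h1 := hjoint m (fun _ => t)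
      have e1 : charFun (gaussianReal 0 w) t
          = (Real.exp (-(v * (∑ u ∈ Finset.range m, t ^ 2) / 2)) : ℂ) := by
        rw [charFun_gaussianReal]
        simp [hw]
        ring_nf
      rw [e1]
      refine h1.congr fun i => ?_
      rw [charFun_apply_real, integral_map (hG2 i).1.aemeasurable (by fun_prop)]
      congr 1; ext ω
      rw [← Finset.mul_sum, Complex.ofReal_mul]
    have h1 := tendsto_integral_min_sq_gaussianReal w
    obtain ⟨L, hL⟩ := (h1.eventually (lt_mem_nhds (sub_lt_self (w : ℝ) hδ))).exists
    refine ⟨L, Nat.cast_nonneg L, ?_⟩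
    have hcont : Continuous (fun x : ℝ => min (x ^ 2) (L : ℝ)) := by fun_prop
    have hlim := tendsto_integral_comp_of_tendsto_charFun (fun i => (hG2 i).1.aemeasurable) hchar
      hcont (C := L) (fun x => by rw [abs_of_nonneg (by positivity)]; exact min_le_right _ _)
    filter_upwards [hlim.eventually (lt_mem_nhds hL), hσ] with i hi hσi
    have hGsq : Integrable (fun ω => G i ω ^ 2) μ := (hG2 i).integrable_sq
    have hmin : Integrable (fun ω => min (G i ω ^ 2) (L : ℝ)) μ := hGsq.inf (integrable_const _)
    have hw' : ∫ ω, G i ω ^ 2 ∂μ = w := by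
      have := (hF i).integral_sq_sum m
      rw [hσi] at this
      rw [hw]; push_cast; exact this
    change ∫ ω, (G i ω ^ 2 - min (G i ω ^ 2) (L : ℝ)) ∂μ ≤ δ
    rw [integral_sub hGsq hmin, hw']
    linarith

/-! ### Block conditions from ergodicity -/

theorem integral_abs_coeFn_le_norm {Ω : Type*} {mΩ : MeasurableSpace Ω} {μ : Measure Ω}
    [IsProbabilityMeasure μ] (h : Lp ℝ 2 μ) : ∫ ω, |h ω| ∂μ ≤ ‖h‖ := by
  refine abs_le_of_sq_le_sq' ?_ (norm_nonneg _) |>.2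
  refine (sq_integral_abs_le (Lp.memLp h)).trans (le_of_eq ?_)
  rw [← real_inner_self_eq_norm_sq, L2.inner_def]
  simp [pow_two]

/-- The mean ergodic theorem for square integrable functions, with convergence in `L¹`. -/
theorem Ergodic.tendsto_integral_abs_average_sub {Ω : Type*} {mΩ : MeasurableSpace Ω}
    {μ : Measure Ω} [IsProbabilityMeasure μ] {T : Ω → Ω} (hT : Ergodic T μ) {g : Ω → ℝ}
    (hg : MemLp g 2 μ) :
    Tendsto (fun n : ℕ => ∫ ω, |(n : ℝ)⁻¹ * ∑ u ∈ Finset.range n, g (T^[u] ω) - ∫ ω', g ω' ∂μ| ∂μ)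
      atTop (𝓝 0) := by
  have hmp : MeasurePreserving T μ μ := hT.toMeasurePreserving
  have hgL : ∀ u, MemLp (fun ω => g (T^[u] ω)) 2 μ := fun u =>
    hg.comp_measurePreserving (hmp.iterate u)
  set U : Lp ℝ 2 μ →ₗᵢ[ℝ] Lp ℝ 2 μ := Lp.compMeasurePreservingₗᵢ ℝ T hmp with hU
  set A : ℕ → Lp ℝ 2 μ := fun n => birkhoffAverage ℝ U _root_.id n (hg.toLp g) with hA
  obtain ⟨P, hPfix, hP⟩ : ∃ P : Lp ℝ 2 μ, U P = P ∧ Tendsto A atTop (𝓝 P) := by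
    have h := U.toContinuousLinearMap.tendsto_birkhoffAverage_orthogonalProjection
      U.norm_toContinuousLinearMap_le (hg.toLp g)
    obtain ⟨P, hP⟩ : ∃ P : U.toContinuousLinearMap.eqLocus (1 : Lp ℝ 2 μ →L[ℝ] Lp ℝ 2 μ),
      Tendsto A atTop (𝓝 (P : Lp ℝ 2 μ)) := ⟨_, h⟩
    exact ⟨P, P.2, hP⟩
  obtain ⟨c, hc⟩ : ∃ c, P =ᵐ[μ] Function.const Ω c := by
    refine hT.ae_eq_const_of_ae_eq_comp_ae (Lp.aestronglyMeasurable P) ?_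
    have h := Lp.coeFn_compMeasurePreserving P hmp
    refine h.symm.trans ?_
    have : Lp.compMeasurePreserving T hmp P = P := hPfix
    rw [this]
  have hiter : ∀ u, U^[u] (hg.toLp g) = (hgL u).toLp _ := by
    intro u
    induction u with
    | zero => rfl
    | succ u ih =>
      rw [Function.iterate_succ_apply', ih]
      change Lp.compMeasurePreserving T hmp _ = _
      rw [Lp.toLp_compMeasurePreserving]
      rfl
  have hAe : ∀ n, A n =ᵐ[μ] fun ω => (n : ℝ)⁻¹ * ∑ u ∈ Finset.range n, g (T^[u] ω) := by
    intro n
    have h1 : A n = (n : ℝ)⁻¹ • ∑ u ∈ Finset.range n, (hgL u).toLp _ := by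
      simp only [hA, birkhoffAverage, birkhoffSum, id_eq, hiter]
    have h2 := Lp.coeFn_smul (n : ℝ)⁻¹ (∑ u ∈ Finset.range n, (hgL u).toLp _)
    have h3 := Lp.coeFn_finsetSum (Finset.range n) (fun u => (hgL u).toLp _)
    have h4 : ∀ᵐ ω ∂μ, ∀ u, (hgL u).toLp _ ω = g (T^[u] ω) :=
      ae_all_iff.2 fun u => (hgL u).coeFn_toLp
    rw [h1]
    filter_upwards [h2, h3, h4] with ω h2 h3 h4
    rw [h2, Pi.smul_apply, h3, smul_eq_mul, Finset.sum_apply]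
    simp_rw [h4]
  have hAint : ∀ n : ℕ, Integrable (fun ω => (n : ℝ)⁻¹ * ∑ u ∈ Finset.range n, g (T^[u] ω)) μ :=
    fun n => (integrable_finsetSum _ fun u _ => (hgL u).integrable (by norm_num)).const_mul _
  have hlim : Tendsto (fun n : ℕ => ∫ ω, |(n : ℝ)⁻¹ * ∑ u ∈ Finset.range n, g (T^[u] ω) - c| ∂μ)
      atTop (𝓝 0) := by
    have h0 : Tendsto (fun n => ‖A n - P‖) atTop (𝓝 0) := tendsto_iff_norm_sub_tendsto_zero.1 hP
    refine squeeze_zero (fun n => integral_nonneg fun ω => abs_nonneg _) (fun n => ?_) h0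
    refine le_trans (le_of_eq (integral_congr_ae ?_)) (integral_abs_coeFn_le_norm (A n - P))
    filter_upwards [hAe n, hc, Lp.coeFn_sub (A n) P] with ω h1 h2 h3
    rw [h3, Pi.sub_apply, h1, h2, Function.const_apply]
  have hmean : ∀ n : ℕ, 0 < n →
      ∫ ω, (n : ℝ)⁻¹ * ∑ u ∈ Finset.range n, g (T^[u] ω) ∂μ = ∫ ω, g ω ∂μ := by
    intro n hn
    rw [integral_const_mul, integral_finsetSum _ fun u _ => (hgL u).integrable (by norm_num)]
    simp_rw [(hmp.iterate _).integral_comp_aestronglyMeasurable hg.1]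
    rw [Finset.sum_const, Finset.card_range, nsmul_eq_mul, inv_mul_cancel_left₀]
    exact_mod_cast hn.ne'
  -- Ergodicity only gives that the limit is some constant `c`; it is the mean because every average
  -- with `n > 0` has integral `∫ g`.
  have hceq : ∫ ω, g ω ∂μ = c := by
    have h1 : Tendsto (fun _ : ℕ => |∫ ω, g ω ∂μ - c|) atTop (𝓝 0) := by
      refine squeeze_zero' (Eventually.of_forall fun n => abs_nonneg _) ?_ hlim
      filter_upwards [eventually_gt_atTop 0] with n hn
      rw [← hmean n hn]
      refine le_trans (le_of_eq ?_) (abs_integral_le_integral_abs)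
      rw [integral_sub (hAint n) (integrable_const c)]
      simp
    have h2 := tendsto_nhds_unique h1 tendsto_const_nhds
    exact sub_eq_zero.1 (abs_eq_zero.1 h2.symm)
  rw [hceq]
  exact hlim

theorem tendsto_integral_sq_sub_min_sq {Ω : Type*} {mΩ : MeasurableSpace Ω} {μ : Measure Ω}
    {G : Ω → ℝ} (hG : MemLp G 2 μ) :
    Tendsto (fun n : ℕ => ∫ ω, (G ω ^ 2 - min (G ω ^ 2) (n : ℝ)) ∂μ) atTop (𝓝 0) := by
  rw [show (0 : ℝ) = ∫ _, (0 : ℝ) ∂μ by simp]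
  refine tendsto_integral_of_dominated_convergence (fun ω => G ω ^ 2) (fun n => ?_)
    hG.integrable_sq (fun n => Eventually.of_forall fun ω => ?_) (Eventually.of_forall fun ω => ?_)
  · have : Continuous (fun x : ℝ => x ^ 2 - min (x ^ 2) (n : ℝ)) := by fun_prop
    exact this.comp_aestronglyMeasurable hG.1
  · rw [Real.norm_of_nonneg (sub_nonneg.2 (min_le_left _ _))]
    exact sub_le_self _ (by positivity)
  · refine tendsto_const_nhds.congr' ?_
    filter_upwards [eventually_ge_atTop ⌈G ω ^ 2⌉₊] with n hn
    rw [min_eq_left ((Nat.le_ceil _).trans (by exact_mod_cast hn)), sub_self]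

/-- `F²` is merely integrable, so it is truncated at a level `K` before the `L²` ergodic theorem is
applied. The truncation error counts twice, once in the sum and once in the mean, and the ergodic
average once: hence the thirds of `δ`. -/
theorem Ergodic.exists_block {Ω : Type*} {mΩ : MeasurableSpace Ω} {μ : Measure Ω}
    [IsProbabilityMeasure μ] {T : Ω → Ω} (hT : Ergodic T μ) {F : Ω → ℝ} (hF : MemLp F 2 μ)
    {δ : ℝ} (hδ : 0 < δ) : ∃ m > 0,
      (∫ ω, |∑ u ∈ Finset.range m, F (T^[u] ω) ^ 2 - m * ∫ ω', F ω' ^ 2 ∂μ| ∂μ ≤ m * δ) ∧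
      ∃ L ≥ (0 : ℝ), ∫ ω, ((∑ u ∈ Finset.range m, F (T^[u] ω)) ^ 2
            - min ((∑ u ∈ Finset.range m, F (T^[u] ω)) ^ 2) L) ∂μ ≤ δ := by
  have hmp : MeasurePreserving T μ μ := hT.toMeasurePreserving
  have hδ3 : 0 < δ / 3 := by positivity
  obtain ⟨K, hK⟩ := ((tendsto_integral_sq_sub_min_sq hF).eventually (gt_mem_nhds hδ3)).exists
  set g : Ω → ℝ := fun ω => min (F ω ^ 2) (K : ℝ) with hg
  have hgm : AEStronglyMeasurable g μ := by
    have : Continuous (fun x : ℝ => min (x ^ 2) (K : ℝ)) := by fun_prop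
    exact this.comp_aestronglyMeasurable hF.1
  have hgL : MemLp g 2 μ := MemLp.of_bound hgm K (Eventually.of_forall fun ω => by
    rw [Real.norm_of_nonneg (by positivity)]; exact min_le_right _ _)
  have hgi : Integrable g μ := hgL.integrable (by norm_num)
  have hFi : Integrable (fun ω => F ω ^ 2) μ := hF.integrable_sq
  obtain ⟨m, hm, hm0⟩ := (((hT.tendsto_integral_abs_average_sub hgL).eventually
    (gt_mem_nhds hδ3)).and (eventually_gt_atTop 0)).exists
  have hm0' : (0 : ℝ) < m := by exact_mod_cast hm0
  refine ⟨m, hm0, ?_, ?_⟩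
  · set s : ℝ := ∫ ω, F ω ^ 2 ∂μ
    set e : ℝ := ∫ ω, g ω ∂μ
    have hse : s - e < δ / 3 := by
      rw [← integral_sub hFi hgi]; exact hK
    have hdi : ∀ u, Integrable (fun ω => F (T^[u] ω) ^ 2 - g (T^[u] ω)) μ := fun u =>
      (hmp.iterate u).integrable_comp_of_integrable (hFi.sub hgi)
    have hdint : ∀ u, ∫ ω, (F (T^[u] ω) ^ 2 - g (T^[u] ω)) ∂μ = s - e := fun u => by
      rw [(hmp.iterate u).integral_comp_aestronglyMeasurable (H := fun ω => F ω ^ 2 - g ω)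
        (hFi.sub hgi).1, integral_sub hFi hgi]
    have hgsum : Integrable (fun ω => ∑ u ∈ Finset.range m, g (T^[u] ω)) μ :=
      integrable_finsetSum _ fun u _ => (hmp.iterate u).integrable_comp_of_integrable hgi
    have hav : Integrable (fun ω => |(m : ℝ)⁻¹ * ∑ u ∈ Finset.range m, g (T^[u] ω) - e|) μ :=
      ((hgsum.const_mul _).sub (integrable_const _)).abs
    have hdsum : Integrable (fun ω => ∑ u ∈ Finset.range m, (F (T^[u] ω) ^ 2 - g (T^[u] ω))) μ :=
      integrable_finsetSum _ fun u _ => hdi u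
    have hes : e ≤ s := integral_mono hgi hFi fun ω => min_le_left _ _
    calc ∫ ω, |∑ u ∈ Finset.range m, F (T^[u] ω) ^ 2 - m * s| ∂μ
        ≤ ∫ ω, (∑ u ∈ Finset.range m, (F (T^[u] ω) ^ 2 - g (T^[u] ω))
          + m * |(m : ℝ)⁻¹ * ∑ u ∈ Finset.range m, g (T^[u] ω) - e| + m * (s - e)) ∂μ := by
          refine integral_mono_of_nonneg (Eventually.of_forall fun ω => abs_nonneg _)
            ((hdsum.add (hav.const_mul _)).add (integrable_const _))
            (Eventually.of_forall fun ω => ?_)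
          have h1 : m * |(m : ℝ)⁻¹ * ∑ u ∈ Finset.range m, g (T^[u] ω) - e|
              = |∑ u ∈ Finset.range m, g (T^[u] ω) - m * e| := by
            rw [← abs_of_pos hm0', ← abs_mul, abs_of_pos hm0', mul_sub, mul_inv_cancel_left₀ hm0'.ne']
          have h2 : 0 ≤ ∑ u ∈ Finset.range m, (F (T^[u] ω) ^ 2 - g (T^[u] ω)) :=
            Finset.sum_nonneg fun u _ => sub_nonneg.2 (min_le_left _ _)
          have h3 : 0 ≤ m * (s - e) := mul_nonneg hm0'.le (sub_nonneg.2 hes)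
          simp only [h1]
          have h4 : ∑ u ∈ Finset.range m, F (T^[u] ω) ^ 2 - m * s
              = ∑ u ∈ Finset.range m, (F (T^[u] ω) ^ 2 - g (T^[u] ω))
                + (∑ u ∈ Finset.range m, g (T^[u] ω) - m * e) - m * (s - e) := by
            rw [Finset.sum_sub_distrib]; ring
          rw [h4]
          refine (abs_sub _ _).trans ?_
          rw [abs_of_nonneg h3]
          gcongr
          refine (abs_add_le _ _).trans ?_
          rw [abs_of_nonneg h2]
      _ = m * (s - e) + m * (∫ ω, |(m : ℝ)⁻¹ * ∑ u ∈ Finset.range m, g (T^[u] ω) - e| ∂μ)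
          + m * (s - e) := by
          rw [integral_add (hdsum.fun_add (hav.const_mul _)) (integrable_const _),
            integral_add hdsum (hav.const_mul _), integral_const_mul,
            integral_finsetSum _ fun u _ => hdi u]
          simp [hdint]
          ring
      _ ≤ m * (δ / 3) + m * (δ / 3) + m * (δ / 3) := by gcongr
      _ = m * δ := by ring
  · have hG : MemLp (fun ω => ∑ u ∈ Finset.range m, F (T^[u] ω)) 2 μ :=
      memLp_finsetSum _ fun u _ => hF.comp_measurePreserving (hmp.iterate u)
    obtain ⟨L, hL⟩ := ((tendsto_integral_sq_sub_min_sq hG).eventually (gt_mem_nhds hδ)).exists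
    exact ⟨L, Nat.cast_nonneg L, hL.le⟩

namespace IsStationaryMartingaleDifference

/-- Orthogonality of the translates; it identifies the limiting variance in the Cramér–Wold argument
as that of independent coordinates. -/
theorem integral_sq_linearCombination {Ω : Type*} {mΩ : MeasurableSpace Ω} {μ : Measure Ω}
    [IsProbabilityMeasure μ] {T : Ω → Ω} {𝒢 : ℕ → MeasurableSpace Ω} {F : Ω → ℝ}
    (h : IsStationaryMartingaleDifference μ T 𝒢 F) (m : ℕ) (a : ℕ → ℝ) :
    ∫ ω, (∑ u ∈ Finset.range m, a u * F (T^[u] ω)) ^ 2 ∂μ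
      = (∑ u ∈ Finset.range m, a u ^ 2) * ∫ ω, F ω ^ 2 ∂μ := by
  induction m with
  | zero => simp
  | succ m ih =>
    set S : Ω → ℝ := fun ω => ∑ u ∈ Finset.range m, a u * F (T^[u] ω) with hS
    have hFm := h.memLp_iterate m
    have hS2 : MemLp S 2 μ := memLp_finsetSum _ fun u _ => (h.memLp_iterate u).const_mul _
    have hmul : ∀ u, Integrable (fun ω => F (T^[u] ω) * F (T^[m] ω)) μ := fun u =>
      (h.memLp_iterate u).integrable_mul hFm
    have hz : ∫ ω, S ω * F (T^[m] ω) ∂μ = 0 := by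
      simp only [hS, Finset.sum_mul, mul_assoc]
      rw [integral_finsetSum _ fun u _ => (hmul u).const_mul _]
      refine Finset.sum_eq_zero fun u hu => ?_
      rw [integral_const_mul, integral_mul_eq_zero_of_forall_setIntegral_eq_zero (h.le u)
        (h.aestronglyMeasurable u) (hFm.integrable (by norm_num)) (hmul u)
        (h.setIntegral_eq_zero u m (Finset.mem_range.1 hu)), mul_zero]
    have e : ∀ ω, (∑ u ∈ Finset.range (m + 1), a u * F (T^[u] ω)) ^ 2
        = S ω ^ 2 + 2 * a m * (S ω * F (T^[m] ω)) + a m ^ 2 * F (T^[m] ω) ^ 2 := by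
      intro ω
      rw [Finset.sum_range_succ]
      change (S ω + _) ^ 2 = _
      ring
    have i1 : Integrable (fun ω => S ω ^ 2) μ := hS2.integrable_sq
    have i2 : Integrable (fun ω => 2 * a m * (S ω * F (T^[m] ω))) μ :=
      (hS2.integrable_mul hFm).const_mul _
    have i3 : Integrable (fun ω => a m ^ 2 * F (T^[m] ω) ^ 2) μ := hFm.integrable_sq.const_mul _
    simp_rw [e]
    rw [integral_add (i1.fun_add i2) i3, integral_add i1 i2, integral_const_mul, hz,
      integral_const_mul, h.integral_sq_iterate, Finset.sum_range_succ, ih]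
    ring

end IsStationaryMartingaleDifference

/-! ### Martingale differences in a set of directions -/

/-- `g` is square integrable and `(g ∘ T_i)` is a field of martingale differences in the directions
belonging to `s`, while nothing is required in the other directions. -/
structure IsMartingaleDifferenceIn {Ω : Type*} {mΩ : MeasurableSpace Ω} {d : ℕ} (μ : Measure Ω)
    (ℱ : Filtration (Fin d → ℤ) mΩ) (s : Finset (Fin d)) (g : Ω → ℝ) : Prop where
  memLp : MemLp g 2 μ
  exists_aestronglyMeasurable : ∃ N : Fin d → ℤ, (∀ q ∈ s, N q = 0) ∧ AEStronglyMeasurable[ℱ N] g μ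
  setIntegral_eq_zero : ∀ i : Fin d → ℤ, (∃ q ∈ s, i q < 0) → ∀ A, MeasurableSet[ℱ i] A →
    ∫ ω in A, g ω ∂μ = 0

theorem IsMartingaleDifferenceIn.mono {Ω : Type*} {mΩ : MeasurableSpace Ω} {d : ℕ} {μ : Measure Ω}
    {ℱ : Filtration (Fin d → ℤ) mΩ} {s s' : Finset (Fin d)}
    {g : Ω → ℝ} (hg : IsMartingaleDifferenceIn μ ℱ s g) (hs : s' ⊆ s) :
    IsMartingaleDifferenceIn μ ℱ s' g where
  memLp := hg.memLp
  exists_aestronglyMeasurable :=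
    let ⟨N, hN, hgN⟩ := hg.exists_aestronglyMeasurable
    ⟨N, fun q hq => hN q (hs hq), hgN⟩
  setIntegral_eq_zero := fun i ⟨q, hq, hi⟩ => hg.setIntegral_eq_zero i ⟨q, hs hq, hi⟩

/-! ### Translates and invariance of the filtration -/

section Shift

variable {Ω : Type*} {mΩ : MeasurableSpace Ω} {μ : Measure Ω}
  {d : ℕ} [AddAction (Fin d → ℤ) Ω] {ℱ : Filtration (Fin d → ℤ) mΩ}

theorem filtration_add_eq_comap
    (hinv : ∀ i : Fin d → ℤ, ℱ i = MeasurableSpace.comap (fun ω : Ω => i +ᵥ ω) (ℱ 0))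
    (i j : Fin d → ℤ) : ℱ (i + j) = MeasurableSpace.comap (fun ω : Ω => j +ᵥ ω) (ℱ i) := by
  rw [hinv (i + j), hinv i, MeasurableSpace.comap_comp]
  congr 1
  ext ω
  exact add_vadd i j ω

variable [MeasurableConstVAdd (Fin d → ℤ) Ω] [VAddInvariantMeasure (Fin d → ℤ) Ω μ]

theorem MeasureTheory.AEStronglyMeasurable.comp_vadd
    (hinv : ∀ i : Fin d → ℤ, ℱ i = MeasurableSpace.comap (fun ω : Ω => i +ᵥ ω) (ℱ 0))
    {N : Fin d → ℤ} {g : Ω → ℝ} (hg : AEStronglyMeasurable[ℱ N] g μ) (j : Fin d → ℤ) :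
    AEStronglyMeasurable[ℱ (N + j)] (fun ω => g (j +ᵥ ω)) μ := by
  obtain ⟨g', hg', hgg'⟩ := hg
  refine ⟨fun ω => g' (j +ᵥ ω), ?_, ?_⟩
  · refine hg'.comp_measurable ?_
    rw [filtration_add_eq_comap hinv]
    exact comap_measurable _
  · exact (measurePreserving_vadd j μ).quasiMeasurePreserving.ae_eq_comp hgg'

namespace IsMartingaleDifferenceIn

variable {s : Finset (Fin d)} {g : Ω → ℝ}

theorem memLp_vadd (hg : IsMartingaleDifferenceIn μ ℱ s g) (j : Fin d → ℤ) :
    MemLp (fun ω => g (j +ᵥ ω)) 2 μ :=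
  hg.memLp.comp_measurePreserving (measurePreserving_vadd j μ)

/-- By invariance `A` is the preimage under `T_j` of a set of `ℱ (i - j)`, and `i - j` has a
negative coordinate in `s`. -/
theorem setIntegral_vadd_eq_zero
    (hinv : ∀ i : Fin d → ℤ, ℱ i = MeasurableSpace.comap (fun ω : Ω => i +ᵥ ω) (ℱ 0))
    (hg : IsMartingaleDifferenceIn μ ℱ s g) {i j : Fin d → ℤ} (hij : ∃ q ∈ s, i q < j q)
    {A : Set Ω} (hA : MeasurableSet[ℱ i] A) : ∫ ω in A, g (j +ᵥ ω) ∂μ = 0 := by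
  rw [show i = (i - j) + j by abel, filtration_add_eq_comap hinv] at hA
  obtain ⟨B, hB, rfl⟩ := hA
  rw [(measurePreserving_vadd j μ).setIntegral_preimage_emb (measurableEmbedding_const_vadd j) g B]
  obtain ⟨q, hq, hlt⟩ := hij
  exact hg.setIntegral_eq_zero _ ⟨q, hq, by simpa using hlt⟩ B hB

end IsMartingaleDifferenceIn

end Shift

/-! ### Rectangular sums -/

section Box

variable {Ω : Type*} {d : ℕ}

/-- The rectangle `∏ q ∈ s, {1, …, n q}`, embedded in `ℤ^d` with zeros in the other coordinates. -/
noncomputable def rectangle (s : Finset (Fin d)) (n : Fin d → ℕ) : Finset (Fin d → ℤ) :=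
  Fintype.piFinset fun q => if q ∈ s then Finset.Icc (1 : ℤ) (n q) else {0}

theorem mem_rectangle {s : Finset (Fin d)} {n : Fin d → ℕ} {i : Fin d → ℤ} :
    i ∈ rectangle s n ↔ ∀ q, (q ∈ s → 1 ≤ i q ∧ i q ≤ n q) ∧ (q ∉ s → i q = 0) := by
  rw [rectangle, Fintype.mem_piFinset]
  refine forall_congr' fun q => ?_
  by_cases hq : q ∈ s <;> simp [hq]

variable [AddAction (Fin d → ℤ) Ω]

/-- The sum over a rectangle in the directions of `s`, normalized by the square root of its
cardinality. -/
noncomputable def rectangleSum (s : Finset (Fin d)) (n : Fin d → ℕ) (g : Ω → ℝ) (ω : Ω) : ℝ :=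
  (√(∏ q ∈ s, (n q : ℝ)))⁻¹ * ∑ i ∈ rectangle s n, g (i +ᵥ ω)

theorem normalizedSum_eq_rectangleSum (f : Ω → ℝ) (n : Fin d → ℕ) :
    normalizedSum f n = rectangleSum Finset.univ n f := by
  ext ω
  simp [normalizedSum, rectangleSum, rectangle]

theorem rectangleSum_empty (n : Fin d → ℕ) (g : Ω → ℝ) : rectangleSum ∅ n g = g := by
  have h : rectangle ∅ n = {0} := by
    ext i
    simp [mem_rectangle, funext_iff]
  ext ω
  simp [rectangleSum, h]

theorem sum_rectangle_insert {s : Finset (Fin d)} {p : Fin d} (hp : p ∉ s) (n : Fin d → ℕ)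
    (φ : (Fin d → ℤ) → ℝ) :
    ∑ i ∈ rectangle (insert p s) n, φ i
      = ∑ k ∈ Finset.range (n p), ∑ i ∈ rectangle s n,
        φ (i + (k + 1) • (Pi.single p 1 : Fin d → ℤ)) := by
  rw [← Finset.sum_product']
  symm
  -- The coordinate in direction `p` runs over `1, …, n p` while `k` starts at `0`, whence `k + 1`
  -- and its inverse `j p - 1`; the remaining index has `p`-coordinate `0`.
  refine Finset.sum_nbij' (fun x => x.2 + (x.1 + 1) • (Pi.single p 1 : Fin d → ℤ))
    (fun j => ((j p - 1).toNat, Function.update j p 0)) ?_ ?_ ?_ ?_ ?_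
  · rintro ⟨k, i⟩ hki
    rw [Finset.mem_product, Finset.mem_range, mem_rectangle] at hki
    obtain ⟨hk, hi⟩ := hki
    rw [mem_rectangle]
    intro q
    have hiq := hi q
    dsimp only at hk hiq ⊢
    by_cases hqp : q = p
    · subst hqp
      have := hiq.2 hp
      simp [this]
      omega
    · simpa [hqp] using hiq
  · intro j hj
    rw [mem_rectangle] at hj
    rw [Finset.mem_product, Finset.mem_range, mem_rectangle]
    have hjp := (hj p).1 (Finset.mem_insert_self p s)
    refine ⟨by dsimp only; omega, fun q => ?_⟩
    dsimp only
    by_cases hqp : q = p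
    · subst hqp
      simp [hp]
    · have := hj q
      simpa [hqp] using this
  · rintro ⟨k, i⟩ hki
    rw [Finset.mem_product, Finset.mem_range, mem_rectangle] at hki
    have hip := (hki.2 p).2 hp
    dsimp only at hip
    refine Prod.ext ?_ ?_
    · simp [hip]
    · ext q
      by_cases hqp : q = p
      · subst hqp; simp [hip]
      · simp [hqp]
  · intro j hj
    rw [mem_rectangle] at hj
    have hjp := (hj p).1 (Finset.mem_insert_self p s)
    ext q
    by_cases hqp : q = p
    · subst hqp
      simp
      omega
    · simp [hqp]
  · intro x _
    rfl

/-- Reduction to one dimension: the new sum is the normalized sum along the orbit of `T_{e_p}` of a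
single function, itself depending on `n`. -/
theorem rectangleSum_insert {s : Finset (Fin d)} {p : Fin d} (hp : p ∉ s) (n : Fin d → ℕ)
    (g : Ω → ℝ) (ω : Ω) :
    rectangleSum (insert p s) n g ω = (√(n p))⁻¹ * ∑ j ∈ Finset.range (n p),
      rectangleSum s n g ((fun ω : Ω => (Pi.single p 1 : Fin d → ℤ) +ᵥ ω)^[j + 1] ω) := by
  simp only [rectangleSum, vadd_iterate]
  rw [Finset.prod_insert hp, Real.sqrt_mul (Nat.cast_nonneg _), mul_inv, mul_assoc,
    ← Finset.mul_sum, sum_rectangle_insert hp n (fun i => g (i +ᵥ ω))]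
  simp only [add_vadd]

theorem rectangleSum_iterate (s : Finset (Fin d)) (p : Fin d) (n : Fin d → ℕ) (g : Ω → ℝ) (k : ℕ)
    (ω : Ω) :
    rectangleSum s n g ((fun ω : Ω => (Pi.single p 1 : Fin d → ℤ) +ᵥ ω)^[k] ω)
      = (√(∏ q ∈ s, (n q : ℝ)))⁻¹ *
        ∑ i ∈ rectangle s n, g ((i + k • (Pi.single p 1 : Fin d → ℤ)) +ᵥ ω) := by
  simp only [rectangleSum, vadd_iterate, add_vadd]

/-- Since the translations commute, a linear combination of translates of the sum is again a
rectangular sum, of another function. This makes the Cramér–Wold device compatible with the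
induction. -/
theorem rectangleSum_linearCombination (s : Finset (Fin d)) (p : Fin d) (n : Fin d → ℕ) (g : Ω → ℝ)
    (m : ℕ) (a : ℕ → ℝ) (ω : Ω) :
    rectangleSum s n (fun ω => ∑ u ∈ Finset.range m,
        a u * g ((fun ω : Ω => (Pi.single p 1 : Fin d → ℤ) +ᵥ ω)^[u] ω)) ω
      = ∑ u ∈ Finset.range m,
        a u * rectangleSum s n g ((fun ω : Ω => (Pi.single p 1 : Fin d → ℤ) +ᵥ ω)^[u] ω) := by
  simp only [rectangleSum_iterate]
  simp only [rectangleSum, vadd_iterate, ← add_vadd]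
  rw [Finset.sum_comm, Finset.mul_sum]
  refine Finset.sum_congr rfl fun u _ => ?_
  rw [← Finset.mul_sum, mul_left_comm]
  simp only [add_comm]

end Box

/-! ### The central limit theorem -/

section CLT

variable {Ω : Type*} {mΩ : MeasurableSpace Ω} {μ : Measure Ω} [IsProbabilityMeasure μ]
  {d : ℕ} [AddAction (Fin d → ℤ) Ω] [MeasurableConstVAdd (Fin d → ℤ) Ω]
  [VAddInvariantMeasure (Fin d → ℤ) Ω μ] {ℱ : Filtration (Fin d → ℤ) mΩ}

namespace IsMartingaleDifferenceIn

/-- Rectangular sums in the directions of `s` form stationary martingale differences in any further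
direction `p`. -/
theorem exists_isStationaryMartingaleDifference
    (hinv : ∀ i : Fin d → ℤ, ℱ i = MeasurableSpace.comap (fun ω : Ω => i +ᵥ ω) (ℱ 0))
    {s : Finset (Fin d)} {p : Fin d} (hp : p ∉ s) {g : Ω → ℝ}
    (hg : IsMartingaleDifferenceIn μ ℱ (insert p s) g) (n : Fin d → ℕ) :
    ∃ 𝒢 : ℕ → MeasurableSpace Ω, IsStationaryMartingaleDifference μ
      (fun ω : Ω => (Pi.single p 1 : Fin d → ℤ) +ᵥ ω) 𝒢 (rectangleSum s n g) := by
  obtain ⟨N, hN, hgN⟩ := hg.exists_aestronglyMeasurable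
  -- `M` is the upper corner reached by the `s`-rectangle, with `M p = 0`. Thus `ℱ (M + k e_p)` sees
  -- all of the `k`-th term, whereas each summand of a later term is placed at a strictly larger
  -- `p`-coordinate.
  set M : Fin d → ℤ := fun q => N q + if q ∈ s then (n q : ℤ) else 0 with hM
  refine ⟨fun k => ℱ (M + k • (Pi.single p 1 : Fin d → ℤ)), ?_⟩
  have hrect : ∀ i ∈ rectangle s n, N + i ≤ M := by
    intro i hi q
    rw [mem_rectangle] at hi
    have := hi q
    by_cases hq : q ∈ s
    · simpa [hM, hq] using (this.1 hq).2
    · simpa [hM, hq] using (this.2 hq).le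
  constructor
  · exact measurePreserving_vadd _ μ
  · exact fun k => ℱ.le _
  · intro k k' hkk'
    refine ℱ.mono ?_
    gcongr
    exact Pi.single_nonneg.2 zero_le_one
  · exact (memLp_finsetSum _ fun i _ => hg.memLp_vadd i).const_mul _
  · intro k
    simp only [rectangleSum_iterate]
    refine AEStronglyMeasurable.const_mul ?_ _
    refine aestronglyMeasurable_sum_of_sub_measurableSpace _ fun i hi => ?_
    refine (hgN.comp_vadd hinv _).mono (ℱ.mono ?_)
    rw [← add_assoc]
    exact add_le_add_left (hrect i hi) _
  · intro k j hkj A hA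
    simp only [rectangleSum_iterate]
    rw [integral_const_mul, integral_finsetSum _ fun i _ =>
      ((hg.memLp_vadd _).integrable (by norm_num)).integrableOn]
    refine mul_eq_zero_of_right _ (Finset.sum_eq_zero fun i hi => ?_)
    refine hg.setIntegral_vadd_eq_zero hinv ⟨p, Finset.mem_insert_self p s, ?_⟩ hA
    have h1 := hN p (Finset.mem_insert_self p s)
    have h2 := ((mem_rectangle.1 hi) p).2 hp
    simpa [hM, h1, h2, hp] using hkj

/-- In each direction the increments are orthogonal, so `n_p` terms normalized by `√n_p` leave the
second moment unchanged. -/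
theorem integral_sq_rectangleSum
    (hinv : ∀ i : Fin d → ℤ, ℱ i = MeasurableSpace.comap (fun ω : Ω => i +ᵥ ω) (ℱ 0))
    {s : Finset (Fin d)} {g : Ω → ℝ} (hg : IsMartingaleDifferenceIn μ ℱ s g) {n : Fin d → ℕ}
    (hn : ∀ q ∈ s, 0 < n q) : ∫ ω, rectangleSum s n g ω ^ 2 ∂μ = ∫ ω, g ω ^ 2 ∂μ := by
  induction s using Finset.induction_on with
  | empty => rw [rectangleSum_empty]
  | insert p s hp ih =>
    obtain ⟨𝒢, h𝒢⟩ := hg.exists_isStationaryMartingaleDifference hinv hp n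
    have h1 := h𝒢.integral_sq_sum_succ 0 (n p)
    simp only [zero_add] at h1
    have hpos : (0 : ℝ) < n p := by exact_mod_cast hn p (Finset.mem_insert_self p s)
    simp only [rectangleSum_insert hp, mul_pow]
    rw [integral_const_mul, h1, inv_pow, Real.sq_sqrt hpos.le, inv_mul_cancel_left₀ hpos.ne']
    exact ih (hg.mono (Finset.subset_insert p s)) fun q hq => hn q (Finset.mem_insert_of_mem hq)

/-- Linear combinations of translates in a direction `p` are martingale differences in the
remaining directions. -/
theorem linearCombination
    (hinv : ∀ i : Fin d → ℤ, ℱ i = MeasurableSpace.comap (fun ω : Ω => i +ᵥ ω) (ℱ 0))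
    {s : Finset (Fin d)} {p : Fin d} (hp : p ∉ s) {g : Ω → ℝ}
    (hg : IsMartingaleDifferenceIn μ ℱ s g) (m : ℕ) (a : ℕ → ℝ) :
    IsMartingaleDifferenceIn μ ℱ s (fun ω => ∑ u ∈ Finset.range m,
      a u * g ((fun ω : Ω => (Pi.single p 1 : Fin d → ℤ) +ᵥ ω)^[u] ω)) := by
  simp only [vadd_iterate]
  obtain ⟨N, hN, hgN⟩ := hg.exists_aestronglyMeasurable
  refine ⟨memLp_finsetSum _ fun u _ => (hg.memLp_vadd _).const_mul _,
    -- Translation spoils `ℱ N`-measurability only in direction `p`, outside `s`, where the index in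
    -- the definition is free.
    ⟨N + m • (Pi.single p 1 : Fin d → ℤ), fun q hq => ?_, ?_⟩, fun i hi A hA => ?_⟩
  · have hqp : q ≠ p := fun h => hp (h ▸ hq)
    simp [hN q hq, hqp]
  · refine aestronglyMeasurable_sum_of_sub_measurableSpace _ fun u hu => ?_
    refine AEStronglyMeasurable.const_mul ((hgN.comp_vadd hinv _).mono (ℱ.mono ?_)) _
    have := (Finset.mem_range.1 hu).le
    gcongr
    exact Pi.single_nonneg.2 zero_le_one
  · rw [integral_finsetSum _ fun u _ =>
      (((hg.memLp_vadd _).integrable (by norm_num)).const_mul _).integrableOn]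
    refine Finset.sum_eq_zero fun u _ => ?_
    rw [integral_const_mul, hg.setIntegral_vadd_eq_zero hinv ?_ hA, mul_zero]
    obtain ⟨q, hq, hiq⟩ := hi
    have hqp : q ≠ p := fun h => hp (h ▸ hq)
    exact ⟨q, hq, by simpa [hqp] using hiq⟩

theorem eventually_integral_sq_rectangleSum
    (hinv : ∀ i : Fin d → ℤ, ℱ i = MeasurableSpace.comap (fun ω : Ω => i +ᵥ ω) (ℱ 0))
    {s : Finset (Fin d)} {g : Ω → ℝ} (hg : IsMartingaleDifferenceIn μ ℱ s g) :
    ∀ᶠ n in Filter.pi fun _ : Fin d => (atTop : Filter ℕ),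
      ∫ ω, rectangleSum s n g ω ^ 2 ∂μ = ∫ ω, g ω ^ 2 ∂μ := by
  have h : ∀ᶠ n in Filter.pi fun _ : Fin d => (atTop : Filter ℕ), ∀ q, 0 < n q :=
    eventually_all.2 fun q => (tendsto_eval_pi _ q).eventually (eventually_gt_atTop 0)
  filter_upwards [h] with n hn
  exact hg.integral_sq_rectangleSum hinv fun q _ => hn q

/-- Adding a direction in which the block conditions hold. -/
theorem tendsto_integral_cexp_insert
    (hinv : ∀ i : Fin d → ℤ, ℱ i = MeasurableSpace.comap (fun ω : Ω => i +ᵥ ω) (ℱ 0))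
    {s : Finset (Fin d)} {p : Fin d} (hp : p ∉ s) {g : Ω → ℝ}
    (hg : IsMartingaleDifferenceIn μ ℱ (insert p s) g)
    (hblock : ∀ δ > 0, ∃ m > 0,
      (∀ᶠ n in Filter.pi fun _ : Fin d => (atTop : Filter ℕ),
        ∫ ω, |∑ u ∈ Finset.range m,
          rectangleSum s n g ((fun ω : Ω => (Pi.single p 1 : Fin d → ℤ) +ᵥ ω)^[u] ω) ^ 2
          - m * ∫ ω, g ω ^ 2 ∂μ| ∂μ ≤ m * δ) ∧
      ∃ L ≥ (0 : ℝ), ∀ᶠ n in Filter.pi fun _ : Fin d => (atTop : Filter ℕ),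
        ∫ ω, ((∑ u ∈ Finset.range m,
          rectangleSum s n g ((fun ω : Ω => (Pi.single p 1 : Fin d → ℤ) +ᵥ ω)^[u] ω)) ^ 2
          - min ((∑ u ∈ Finset.range m,
            rectangleSum s n g ((fun ω : Ω => (Pi.single p 1 : Fin d → ℤ) +ᵥ ω)^[u] ω)) ^ 2) L) ∂μ
          ≤ δ) (t : ℝ) :
    Tendsto (fun n => ∫ ω, Complex.exp
      (((t * rectangleSum (insert p s) n g ω : ℝ) : ℂ) * Complex.I) ∂μ)
      (Filter.pi fun _ : Fin d => (atTop : Filter ℕ))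
      (𝓝 (Real.exp (-(t ^ 2 * (∫ ω, g ω ^ 2 ∂μ) / 2)) : ℂ)) := by
  choose 𝒢 h𝒢 using fun n => hg.exists_isStationaryMartingaleDifference hinv hp n
  simp only [rectangleSum_insert hp]
  exact tendsto_integral_cexp_of_blocks (tendsto_eval_pi _ p) h𝒢
    ((hg.mono (Finset.subset_insert p s)).eventually_integral_sq_rectangleSum hinv) hblock t

/-- Induction on the directions other than `q₀`, with `g` arbitrary: the step for `g` uses the limit
law for the functions `∑ a_u g ∘ T_{e_p}^u`. Ergodicity is consumed in the base case. -/
theorem tendsto_integral_cexp_rectangleSum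
    (hinv : ∀ i : Fin d → ℤ, ℱ i = MeasurableSpace.comap (fun ω : Ω => i +ᵥ ω) (ℱ 0))
    {q₀ : Fin d} (herg : Ergodic (fun ω : Ω => (Pi.single q₀ 1 : Fin d → ℤ) +ᵥ ω) μ)
    {s : Finset (Fin d)} (hq₀ : q₀ ∉ s) {g : Ω → ℝ}
    (hg : IsMartingaleDifferenceIn μ ℱ (insert q₀ s) g) (t : ℝ) :
    Tendsto (fun n => ∫ ω, Complex.exp
      (((t * rectangleSum (insert q₀ s) n g ω : ℝ) : ℂ) * Complex.I) ∂μ)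
      (Filter.pi fun _ : Fin d => (atTop : Filter ℕ))
      (𝓝 (Real.exp (-(t ^ 2 * (∫ ω, g ω ^ 2 ∂μ) / 2)) : ℂ)) := by
  induction s using Finset.induction_on generalizing g t with
  | empty =>
    refine hg.tendsto_integral_cexp_insert hinv hq₀ (fun δ hδ => ?_) t
    obtain ⟨m, hm, h1, L, hL, h2⟩ := herg.exists_block hg.memLp hδ
    refine ⟨m, hm, Eventually.of_forall fun n => ?_, L, hL, Eventually.of_forall fun n => ?_⟩
    · rw [rectangleSum_empty]; exact h1
    · rw [rectangleSum_empty]; exact h2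
  | insert p s hps ih =>
    rw [Finset.mem_insert, not_or] at hq₀
    have hp : p ∉ insert q₀ s := by
      rw [Finset.mem_insert, not_or]; exact ⟨fun h => hq₀.1 h.symm, hps⟩
    rw [Finset.insert_comm] at hg ⊢
    have hgs := hg.mono (Finset.subset_insert p _)
    refine hg.tendsto_integral_cexp_insert hinv hp (fun δ hδ => ?_) t
    choose 𝒢 h𝒢 using fun n => hg.exists_isStationaryMartingaleDifference hinv hp n
    -- Direction `p` alone with an empty set of summation directions: `g` itself is a martingale
    -- difference along `T_{e_p}`. The side lengths `0` play no role, as the rectangle is a single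
    -- point.
    obtain ⟨𝒢', h𝒢'⟩ := (hg.mono (s' := insert p ∅) (by simp)).exists_isStationaryMartingaleDifference
      hinv (Finset.notMem_empty p) 0
    rw [rectangleSum_empty] at h𝒢'
    set v : NNReal := ⟨∫ ω, g ω ^ 2 ∂μ, integral_nonneg fun ω => sq_nonneg _⟩ with hv
    refine exists_block_of_tendsto_joint (v := v) h𝒢
      (hgs.eventually_integral_sq_rectangleSum hinv) (fun m a => ?_) hδ
    -- The frequency `1` suffices, as the coefficients `a` are arbitrary.
    have h1 := ih hq₀.2 (hgs.linearCombination hinv hp m a) 1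
    rw [h𝒢'.integral_sq_linearCombination m a] at h1
    simp only [one_mul, one_pow, rectangleSum_linearCombination] at h1
    rw [mul_comm] at h1
    exact h1

end IsMartingaleDifferenceIn

end CLT

/-! ### From the hypotheses to the limit theorem -/

theorem IsMartingaleDifferenceField.isMartingaleDifferenceIn_univ {Ω : Type*}
    {mΩ : MeasurableSpace Ω} {μ : Measure Ω} [IsProbabilityMeasure μ] {d : ℕ}
    [AddAction (Fin d → ℤ) Ω] {ℱ : Filtration (Fin d → ℤ) mΩ}
    (hℱ : IsCompletelyCommutingFiltration μ ℱ) {f : Ω → ℝ} (hf : MemLp f 2 μ)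
    (hmd : IsMartingaleDifferenceField μ ℱ f) :
    IsMartingaleDifferenceIn μ ℱ Finset.univ f where
  memLp := hf
  exists_aestronglyMeasurable := ⟨0, fun _ _ => rfl, hmd.measurable⟩
  setIntegral_eq_zero := by
    rintro i ⟨q, -, hq⟩ A hA
    have hfi : Integrable f μ := hf.integrable (by norm_num)
    have h0 : μ[f | ℱ 0] =ᵐ[μ] f := condExp_of_aestronglyMeasurable' (ℱ.le 0) hmd.measurable hfi
    -- As `f = E(f | ℱ_0)`, complete commutation gives `E(f | ℱ_i) = E(f | ℱ_{0 ∧ i})`. The index `0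
    -- ∧ i` is nonpositive with a negative coordinate even when `i` has positive ones.
    have h1 : μ[f | ℱ i] =ᵐ[μ] 0 := by
      refine (condExp_congr_ae h0.symm).trans ((hℱ.condExp_condExp f hfi 0 i).trans ?_)
      exact hmd.condExp_eq_zero _ (fun q => inf_le_left) ⟨q, inf_le_right.trans_lt hq⟩
    rw [← setIntegral_condExp (ℱ.le i) hfi hA, integral_congr_ae (ae_restrict_of_ae h1)]
    simp

theorem toNNReal_eLpNorm_two_sq {Ω : Type*} {mΩ : MeasurableSpace Ω} {μ : Measure Ω} {f : Ω → ℝ}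
    (hf : MemLp f 2 μ) : (((eLpNorm f 2 μ).toNNReal ^ 2 : NNReal) : ℝ) = ∫ ω, f ω ^ 2 ∂μ := by
  have h : ‖hf.toLp f‖ ^ 2 = ∫ ω, f ω ^ 2 ∂μ := by
    rw [← real_inner_self_eq_norm_sq, L2.inner_def]
    refine integral_congr_ae ?_
    filter_upwards [hf.coeFn_toLp] with ω hω
    rw [hω]
    simp [pow_two]
  rw [← h, Lp.norm_toLp, NNReal.coe_pow]
  rfl

theorem mainTheorem1 {Ω : Type*} {mΩ : MeasurableSpace Ω} (μ : Measure Ω) [IsProbabilityMeasure μ]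
    {d : ℕ} [AddAction (Fin d → ℤ) Ω] [MeasurableConstVAdd (Fin d → ℤ) Ω]
    [VAddInvariantMeasure (Fin d → ℤ) Ω μ]
    (ℱ : Filtration (Fin d → ℤ) mΩ) (hℱ : IsCompletelyCommutingFiltration μ ℱ)
    (f : Ω → ℝ) (hf : MemLp f 2 μ) (hmd : IsMartingaleDifferenceField μ ℱ f)
    (herg : ∃ q : Fin d, Ergodic (fun ω : Ω => (Pi.single q 1 : Fin d → ℤ) +ᵥ ω) μ) :
    TendstoInDistribution (fun n : Fin d → ℕ => normalizedSum (Ω := Ω) f n)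
      (Filter.pi fun _ : Fin d => atTop) id (fun _ => μ)
      (gaussianReal 0 ((eLpNorm f 2 μ).toNNReal ^ 2)) := by
  obtain ⟨q₀, hq₀⟩ := herg
  have hD := hmd.isMartingaleDifferenceIn_univ hℱ hf
  have hmeas : ∀ n : Fin d → ℕ, AEMeasurable (normalizedSum (Ω := Ω) f n) μ := fun n => by
    have h : MemLp (normalizedSum (Ω := Ω) f n) 2 μ :=
      (memLp_finsetSum _ fun i _ => hD.memLp_vadd i).const_mul _
    exact h.1.aemeasurable
  refine ⟨hmeas, aemeasurable_id, tendsto_probabilityMeasure_of_tendsto_charFun fun t => ?_⟩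
  have hins : insert q₀ (Finset.univ.erase q₀) = (Finset.univ : Finset (Fin d)) :=
    Finset.insert_erase (Finset.mem_univ q₀)
  have h1 := (hins.symm ▸ hD).tendsto_integral_cexp_rectangleSum hℱ.invariant hq₀
    (Finset.notMem_erase q₀ _) t
  rw [hins] at h1
  have e1 : charFun ((gaussianReal 0 ((eLpNorm f 2 μ).toNNReal ^ 2)).map id) t
      = (Real.exp (-(t ^ 2 * (∫ ω, f ω ^ 2 ∂μ) / 2)) : ℂ) := by
    rw [Measure.map_id, charFun_gaussianReal, ← toNNReal_eLpNorm_two_sq hf, Complex.ofReal_exp]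
    congr 1
    push_cast
    ring
  change Tendsto (fun n => charFun (μ.map (normalizedSum (Ω := Ω) f n)) t) _
    (𝓝 (charFun ((gaussianReal 0 ((eLpNorm f 2 μ).toNNReal ^ 2)).map id) t))
  rw [e1]
  refine h1.congr fun n => ?_
  rw [charFun_apply_real, integral_map (hmeas n) (by fun_prop), normalizedSum_eq_rectangleSum]
  simp only [Complex.ofReal_mul]
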